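/- Let $\mathbb K=\mathbb R$ or $\mathbb C$. Let $w=(w_i)_{i\ge 1}$ be an admissible sequence, i.e. a decreasing (in the wide sense) sequence of nonnegative real numbers with $w_1=1$, $\lim_i w_i=0$ and $\sum_i w_i=\infty$, and put $W(n)=\sum_{i=1}^n w_i$. For a bounded sequence $x$ of elements of $\mathbb K$ let $x^*=(x^*(i))_{i\ge1}$ be its decreasing rearrangement, $x^*(i)=\inf\{t\ge 0:\ \#\{j:|x(j)|>t\}\le i-1\}$, and let $X=d_*(w,1)$ be the space of all bounded sequences $x$ in $\mathbb K$ with $$\lim_{n\to\infty}\frac{\sum_{i=1}^n x^*(i)}{W(n)}=0,\qquad\text{normed by}\qquad \|x\|_W=\sup_{n\ge1}\frac{\sum_{i=1}^n x^*(i)}{W(n)}$$ (the predual of the Lorentz sequence space $d(w,1)$). For $N\ge 0$ let $\mathcal P(^NX)$ be the space of continuous $N$-homogeneous polynomials $p\colon X\to\mathbb K$, i.e. $p(x)=\Phi(x,\dots,x)$ for some continuous $N$-linear form $\Phi$ on $X$, and for $k\ge 0$ let $\mathcal P_k(X)$ be the space of continuous polynomials $X\to\mathbb K$ of degree at most $k$,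 i.e. of sums $p_0+\dots+p_k$ with $p_j\in\mathcal P(^jX)$; both carry the norm $\|p\|=\sup_{\|x\|_W\le1}|p(x)|$. A polynomial $p$ is norm attaining if $|p(x_0)|=\|p\|$ for some $x_0\in X$ with $\|x_0\|_W\le1$. Then, for every integer $N\ge2$, the following are equivalent: (i) the norm attaining polynomials in $\mathcal P(^NX)$ are dense in $\mathcal P(^NX)$; (ii) for every integer $k\ge N$, every $q\in\mathcal P(^NX)$ can be approximated by norm attaining polynomials of $\mathcal P_k(X)$: for every $\varepsilon>0$ there is a norm attaining $p\in\mathcal P_k(X)$ with $\|q-p\|<\varepsilon$; (iii) $w\notin\ell_N$, i.e. $\sum_{i=1}^\infty w_i^N=\infty$. -/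

import Mathlib

open Filter Topology

/-- An admissible sequence: a decreasing sequence of nonnegative reals with first term `1`,
limit `0` and divergent series. Sequences are indexed from `0`. -/
structure AdmissibleSeq where
  /-- The underlying sequence. -/
  toFun : ℕ → ℝ
  antitone' : Antitone toFun
  nonneg' : ∀ i, 0 ≤ toFun i
  zero' : toFun 0 = 1
  tendsto_zero' : Tendsto toFun atTop (𝓝 0)
  tendsto_sum' : Tendsto (fun n => ∑ i ∈ Finset.range n, toFun i) atTop atTop

instance : CoeFun AdmissibleSeq (fun _ => ℕ → ℝ) := ⟨AdmissibleSeq.toFun⟩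

section Rearrangement

variable {𝕜 : Type*} [RCLike 𝕜]

/-- The decreasing rearrangement of a bounded sequence `x`: its `n`-th term (from `n = 0`) is the
least `t ≥ 0` such that at most `n` of the terms of `x` have modulus larger than `t`. -/
noncomputable def decreasingRearrangement (x : ℕ → 𝕜) (n : ℕ) : ℝ :=
  sInf {t : ℝ | 0 ≤ t ∧ {i | t < ‖x i‖}.encard ≤ n}

theorem decreasingRearrangement_nonneg (x : ℕ → 𝕜) (n : ℕ) : 0 ≤ decreasingRearrangement x n :=
  Real.sInf_nonneg fun _ ht => ht.1

/-- The quotient `(x*(1) + ⋯ + x*(n+1)) / (w 1 + ⋯ + w (n+1))` of the Lorentz norm, in one-based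
notation for the sequences. -/
noncomputable def lorentzRatio (w : AdmissibleSeq) (x : ℕ → 𝕜) (n : ℕ) : ℝ :=
  (∑ i ∈ Finset.range (n + 1), decreasingRearrangement x i) / ∑ i ∈ Finset.range (n + 1), w i

theorem sum_le_sum_decreasingRearrangement {x : ℕ → 𝕜} (hx : BddAbove (Set.range fun i => ‖x i‖))
    (n : ℕ) (A : Finset ℕ) (hA : A.card = n) :
    ∑ i ∈ A, ‖x i‖ ≤ ∑ i ∈ Finset.range n, decreasingRearrangement x i := by
  induction n generalizing A with
  | zero => simp [Finset.card_eq_zero.mp hA]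
  | succ n ih =>
    have hne : A.Nonempty := by
      rw [← Finset.card_pos]; omega
    obtain ⟨j, hj, hmin⟩ := A.exists_min_image (fun i => ‖x i‖) hne
    rw [← Finset.sum_erase_add A _ hj, Finset.sum_range_succ]
    refine add_le_add (ih _ (by rw [Finset.card_erase_of_mem hj]; omega)) ?_
    obtain ⟨C, hC⟩ := hx
    have hC' : ∀ i, ‖x i‖ ≤ C := fun i => hC ⟨i, rfl⟩
    refine le_csInf ⟨C, (norm_nonneg _).trans (hC' 0), ?_⟩ ?_
    · have : {i | C < ‖x i‖} = ∅ := by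
        ext i; simp [hC' i]
      simp [this]
    · rintro t ⟨_, ht⟩
      by_contra hlt
      push Not at hlt
      have hsub : (A : Set ℕ) ⊆ {i | t < ‖x i‖} := fun i hi => hlt.trans_le (hmin i hi)
      have h1 := (Set.encard_le_encard hsub).trans ht
      rw [Set.encard_coe_eq_coe_finsetCard, hA] at h1
      have h2 : n + 1 ≤ n := by exact_mod_cast h1
      omega

theorem exists_sum_decreasingRearrangement_le (x : ℕ → 𝕜) (n : ℕ) {ε : ℝ} (hε : 0 < ε) :
    ∃ A : Finset ℕ, A.card = n ∧
      ∑ i ∈ Finset.range n, decreasingRearrangement x i ≤ ∑ i ∈ A, ‖x i‖ + n * ε := by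
  induction n with
  | zero => exact ⟨∅, by simp⟩
  | succ n ih =>
    obtain ⟨A, hA, hsum⟩ := ih
    have key : ∃ j, j ∉ A ∧ decreasingRearrangement x n ≤ ‖x j‖ + ε := by
      by_cases hs : decreasingRearrangement x n ≤ ε
      · obtain ⟨j, hj⟩ := Infinite.exists_notMem_finset A
        exact ⟨j, hj, by linarith [norm_nonneg (x j)]⟩
      · push Not at hs
        by_contra hcon
        push Not at hcon
        have hmem : decreasingRearrangement x n - ε ∈
            {t : ℝ | 0 ≤ t ∧ {i | t < ‖x i‖}.encard ≤ n} := by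
          refine ⟨by linarith, ?_⟩
          have hsub : {i | decreasingRearrangement x n - ε < ‖x i‖} ⊆ (A : Set ℕ) := by
            intro i hi
            by_contra hiA
            have h1 := hcon i hiA
            have h2 : decreasingRearrangement x n - ε < ‖x i‖ := hi
            linarith
          refine (Set.encard_le_encard hsub).trans ?_
          rw [Set.encard_coe_eq_coe_finsetCard, hA]
        have h3 : decreasingRearrangement x n ≤ decreasingRearrangement x n - ε :=
          csInf_le ⟨0, fun t ht => ht.1⟩ hmem
        linarith
    obtain ⟨j, hj, hle⟩ := key
    refine ⟨insert j A, by rw [Finset.card_insert_of_notMem hj, hA], ?_⟩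
    rw [Finset.sum_insert hj, Finset.sum_range_succ]
    push_cast
    linarith

theorem sum_decreasingRearrangement_add_le {x y : ℕ → 𝕜}
    (hx : BddAbove (Set.range fun i => ‖x i‖)) (hy : BddAbove (Set.range fun i => ‖y i‖)) (n : ℕ) :
    ∑ i ∈ Finset.range n, decreasingRearrangement (x + y) i ≤
      ∑ i ∈ Finset.range n, decreasingRearrangement x i +
        ∑ i ∈ Finset.range n, decreasingRearrangement y i := by
  refine le_of_forall_pos_le_add fun ε hε => ?_
  obtain ⟨A, hA, h⟩ := exists_sum_decreasingRearrangement_le (x + y) n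
    (show 0 < ε / (n + 1) by positivity)
  have h1 : (n : ℝ) * (ε / (n + 1)) ≤ ε := by
    rw [mul_div_assoc', div_le_iff₀ (by positivity)]; nlinarith
  have h2 : ∑ i ∈ A, ‖(x + y) i‖ ≤ ∑ i ∈ A, ‖x i‖ + ∑ i ∈ A, ‖y i‖ := by
    rw [← Finset.sum_add_distrib]
    exact Finset.sum_le_sum fun i _ => norm_add_le _ _
  linarith [sum_le_sum_decreasingRearrangement hx n A hA,
    sum_le_sum_decreasingRearrangement hy n A hA]

theorem sum_decreasingRearrangement_smul_le (c : 𝕜) {x : ℕ → 𝕜}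
    (hx : BddAbove (Set.range fun i => ‖x i‖)) (n : ℕ) :
    ∑ i ∈ Finset.range n, decreasingRearrangement (c • x) i ≤
      ‖c‖ * ∑ i ∈ Finset.range n, decreasingRearrangement x i := by
  refine le_of_forall_pos_le_add fun ε hε => ?_
  obtain ⟨A, hA, h⟩ := exists_sum_decreasingRearrangement_le (c • x) n
    (show 0 < ε / (n + 1) by positivity)
  have h1 : (n : ℝ) * (ε / (n + 1)) ≤ ε := by
    rw [mul_div_assoc', div_le_iff₀ (by positivity)]; nlinarith
  have h2 : ∑ i ∈ A, ‖(c • x) i‖ = ‖c‖ * ∑ i ∈ A, ‖x i‖ := by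
    rw [Finset.mul_sum]
    exact Finset.sum_congr rfl fun i _ => by simp
  have h3 := mul_le_mul_of_nonneg_left (sum_le_sum_decreasingRearrangement hx n A hA)
    (norm_nonneg c)
  linarith

theorem AdmissibleSeq.sum_pos (w : AdmissibleSeq) (n : ℕ) :
    0 < ∑ i ∈ Finset.range (n + 1), w i :=
  Finset.sum_pos' (fun i _ => w.nonneg' i) ⟨0, by simp, by rw [w.zero']; exact one_pos⟩

theorem lorentzRatio_nonneg (w : AdmissibleSeq) (x : ℕ → 𝕜) (n : ℕ) : 0 ≤ lorentzRatio w x n :=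
  div_nonneg (Finset.sum_nonneg fun i _ => decreasingRearrangement_nonneg x i) (w.sum_pos n).le

theorem lorentzRatio_add_le (w : AdmissibleSeq) {x y : ℕ → 𝕜}
    (hx : BddAbove (Set.range fun i => ‖x i‖)) (hy : BddAbove (Set.range fun i => ‖y i‖)) (n : ℕ) :
    lorentzRatio w (x + y) n ≤ lorentzRatio w x n + lorentzRatio w y n := by
  unfold lorentzRatio
  rw [← add_div]
  exact div_le_div_of_nonneg_right (sum_decreasingRearrangement_add_le hx hy _) (w.sum_pos n).le

theorem lorentzRatio_smul_le (w : AdmissibleSeq) (c : 𝕜) {x : ℕ → 𝕜}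
    (hx : BddAbove (Set.range fun i => ‖x i‖)) (n : ℕ) :
    lorentzRatio w (c • x) n ≤ ‖c‖ * lorentzRatio w x n := by
  unfold lorentzRatio
  rw [← mul_div_assoc]
  exact div_le_div_of_nonneg_right (sum_decreasingRearrangement_smul_le c hx _) (w.sum_pos n).le

theorem decreasingRearrangement_zero (n : ℕ) : decreasingRearrangement (0 : ℕ → 𝕜) n = 0 := by
  refine le_antisymm (csInf_le ⟨0, fun t ht => ht.1⟩ ⟨le_rfl, ?_⟩)
    (decreasingRearrangement_nonneg _ _)
  simp

theorem lorentzRatio_zero (w : AdmissibleSeq) (n : ℕ) : lorentzRatio w (0 : ℕ → 𝕜) n = 0 := by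
  simp [lorentzRatio, decreasingRearrangement_zero]

end Rearrangement

section Space

variable (𝕜 : Type*) [RCLike 𝕜]

/-- The linear subspace of `ℕ → 𝕜` underlying `d_*(w,1)`: the bounded sequences `x` for which
`(∑_{i ≤ n} x*(i)) / (∑_{i ≤ n} w i)` tends to `0`. -/
def lorentzPredualSubmodule (w : AdmissibleSeq) : Submodule 𝕜 (ℕ → 𝕜) where
  carrier := {x | BddAbove (Set.range fun i => ‖x i‖) ∧
    Tendsto (lorentzRatio w x) atTop (𝓝 0)}
  zero_mem' := by
    refine ⟨⟨0, ?_⟩, ?_⟩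
    · rintro _ ⟨i, rfl⟩; simp
    · have : lorentzRatio w (0 : ℕ → 𝕜) = fun _ => 0 := funext (lorentzRatio_zero w)
      rw [this]; exact tendsto_const_nhds
  add_mem' := by
    rintro x y ⟨hx, hx'⟩ ⟨hy, hy'⟩
    refine ⟨?_, ?_⟩
    · obtain ⟨C, hC⟩ := hx
      obtain ⟨D, hD⟩ := hy
      refine ⟨C + D, ?_⟩
      rintro _ ⟨i, rfl⟩
      exact (norm_add_le _ _).trans (add_le_add (hC ⟨i, rfl⟩) (hD ⟨i, rfl⟩))
    · refine squeeze_zero (lorentzRatio_nonneg w _) (lorentzRatio_add_le w hx hy) ?_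
      simpa using hx'.add hy'
  smul_mem' := by
    rintro c x ⟨hx, hx'⟩
    refine ⟨?_, ?_⟩
    · obtain ⟨C, hC⟩ := hx
      refine ⟨‖c‖ * C, ?_⟩
      rintro _ ⟨i, rfl⟩
      have := mul_le_mul_of_nonneg_left (hC ⟨i, rfl⟩) (norm_nonneg c)
      simpa using this
    · refine squeeze_zero (lorentzRatio_nonneg w _) (lorentzRatio_smul_le w c hx) ?_
      simpa using hx'.const_mul ‖c‖

/-- The space `d_*(w,1)` over `𝕜`, the predual of the Lorentz sequence space `d(w,1)`. It is kept
apart from the submodule, so that its only topology is that of the norm below. -/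
def LorentzPredual (w : AdmissibleSeq) : Type _ := lorentzPredualSubmodule 𝕜 w

namespace LorentzPredual

variable {𝕜} {w : AdmissibleSeq}

noncomputable instance : AddCommGroup (LorentzPredual 𝕜 w) :=
  inferInstanceAs (AddCommGroup (lorentzPredualSubmodule 𝕜 w))

noncomputable instance : Module 𝕜 (LorentzPredual 𝕜 w) :=
  inferInstanceAs (Module 𝕜 (lorentzPredualSubmodule 𝕜 w))

instance : CoeFun (LorentzPredual 𝕜 w) (fun _ => ℕ → 𝕜) := ⟨Subtype.val⟩

theorem bddAbove_ratio (x : LorentzPredual 𝕜 w) : BddAbove (Set.range (lorentzRatio w x)) :=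
  x.2.2.bddAbove_range

/-- The norm `‖x‖_W = sup_n (∑_{i ≤ n} x*(i)) / W(n)` of `d_*(w,1)`. -/
noncomputable instance : NormedAddCommGroup (LorentzPredual 𝕜 w) :=
  AddGroupNorm.toNormedAddCommGroup
    { toFun := fun x => ⨆ n, lorentzRatio w x n
      map_zero' := by
        have h : ∀ n, lorentzRatio w ((0 : LorentzPredual 𝕜 w) : ℕ → 𝕜) n = 0 :=
          lorentzRatio_zero w
        simp [h]
      add_le' := fun x y => ciSup_le fun n =>
        (lorentzRatio_add_le w x.2.1 y.2.1 n).trans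
          (add_le_add (le_ciSup x.bddAbove_ratio n) (le_ciSup y.bddAbove_ratio n))
      neg' := fun x => by
        have h : lorentzRatio w ((-x : LorentzPredual 𝕜 w) : ℕ → 𝕜) =
            lorentzRatio w (x : ℕ → 𝕜) := by
          have h1 : ((-x : LorentzPredual 𝕜 w) : ℕ → 𝕜) = -(x : ℕ → 𝕜) := rfl
          funext n
          simp [lorentzRatio, decreasingRearrangement, h1]
        rw [h]
      eq_zero_of_map_eq_zero' := fun x hx => by
        refine Subtype.ext (funext fun i => ?_)
        have h0 : lorentzRatio w x 0 ≤ 0 := hx ▸ le_ciSup x.bddAbove_ratio 0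
        have h1 := sum_le_sum_decreasingRearrangement x.2.1 1 {i} (by simp)
        simp only [lorentzRatio, zero_add, Finset.sum_range_one, w.zero', div_one] at h0
        simp only [Finset.sum_singleton, Finset.sum_range_one] at h1
        exact norm_le_zero_iff.mp (h1.trans h0) }

theorem norm_def (x : LorentzPredual 𝕜 w) : ‖x‖ = ⨆ n, lorentzRatio w x n := rfl

noncomputable instance : NormedSpace 𝕜 (LorentzPredual 𝕜 w) where
  norm_smul_le c x := ciSup_le fun n =>
    (lorentzRatio_smul_le w c x.2.1 n).trans
      (mul_le_mul_of_nonneg_left (le_ciSup x.bddAbove_ratio n) (norm_nonneg c))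

end LorentzPredual

end Space

section Polynomials

variable (𝕜 : Type*) [RCLike 𝕜] (X : Type*) [NormedAddCommGroup X] [NormedSpace 𝕜 X]

/-- `𝒫(ᴺX)`: the continuous `N`-homogeneous polynomials `X → 𝕜`, i.e. the functions
`x ↦ Φ(x, …, x)` with `Φ` a continuous `N`-linear form. -/
def homogeneousPolynomials (N : ℕ) : Set (X → 𝕜) :=
  {p | ∃ Φ : ContinuousMultilinearMap 𝕜 (fun _ : Fin N => X) 𝕜, ∀ x, p x = Φ fun _ => x}

/-- `𝒫_k(X)`: the continuous polynomials `X → 𝕜` of degree at most `k`, i.e. the sums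
`p_0 + ⋯ + p_k` with `p_j` a continuous `j`-homogeneous polynomial. -/
def polynomialsOfDegreeLE (k : ℕ) : Set (X → 𝕜) :=
  {p | ∃ q : ℕ → X → 𝕜, (∀ j, q j ∈ homogeneousPolynomials 𝕜 X j) ∧
    ∀ x, p x = ∑ j ∈ Finset.range (k + 1), q j x}

variable {𝕜 X}

/-- The supremum norm `sup {|p(x)| : ‖x‖ ≤ 1}`; continuous polynomials are bounded on the unit
ball, see `bddAbove_of_mem_polynomialsOfDegreeLE`. -/
noncomputable def ballSupNorm (p : X → 𝕜) : ℝ :=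
  ⨆ x : Metric.closedBall (0 : X) 1, ‖p x‖

/-- `p` attains its supremum norm at a point of the closed unit ball. -/
def IsNormAttaining (p : X → 𝕜) : Prop :=
  ∃ x₀ : X, ‖x₀‖ ≤ 1 ∧ ‖p x₀‖ = ballSupNorm p

theorem bddAbove_of_mem_homogeneousPolynomials {N : ℕ} {p : X → 𝕜}
    (hp : p ∈ homogeneousPolynomials 𝕜 X N) :
    BddAbove (Set.range fun x : Metric.closedBall (0 : X) 1 => ‖p x‖) := by
  obtain ⟨Φ, hΦ⟩ := hp
  refine ⟨‖Φ‖, ?_⟩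
  rintro _ ⟨⟨x, hx⟩, rfl⟩
  have hx' : ‖x‖ ≤ 1 := by simpa using hx
  simp only [hΦ]
  refine (Φ.le_opNorm _).trans ?_
  refine mul_le_of_le_one_right (norm_nonneg _) ?_
  simpa using pow_le_one₀ (norm_nonneg x) hx'

theorem bddAbove_of_mem_polynomialsOfDegreeLE {k : ℕ} {p : X → 𝕜}
    (hp : p ∈ polynomialsOfDegreeLE 𝕜 X k) :
    BddAbove (Set.range fun x : Metric.closedBall (0 : X) 1 => ‖p x‖) := by
  obtain ⟨q, hq, hpq⟩ := hp
  choose C hC using fun j => bddAbove_of_mem_homogeneousPolynomials (hq j)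
  refine ⟨∑ j ∈ Finset.range (k + 1), C j, ?_⟩
  rintro _ ⟨x, rfl⟩
  simp only [hpq]
  exact (norm_sum_le _ _).trans (Finset.sum_le_sum fun j _ => hC j ⟨x, rfl⟩)

/-- Every member of `B` is approximated, as closely as desired in the supremum norm on the unit
ball, by members of `A`; when `A ⊆ B` this says that `A` is dense in `B`. -/
def ApproximatedBy (B A : Set (X → 𝕜)) : Prop :=
  ∀ q ∈ B, ∀ ε > 0, ∃ p ∈ A, ballSupNorm (q - p) < ε

variable (𝕜 X)

/-- `NA𝒫(ᴺX)`: the norm attaining continuous `N`-homogeneous polynomials. -/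
def normAttainingHomogeneousPolynomials (N : ℕ) : Set (X → 𝕜) :=
  {p | p ∈ homogeneousPolynomials 𝕜 X N ∧ IsNormAttaining p}

/-- `NA𝒫_k(X)`: the norm attaining continuous polynomials of degree at most `k`. -/
def normAttainingPolynomialsOfDegreeLE (k : ℕ) : Set (X → 𝕜) :=
  {p | p ∈ polynomialsOfDegreeLE 𝕜 X k ∧ IsNormAttaining p}

end Polynomials

/-! The exponents `j` with `w ∈ ℓ_j` decide whether a multilinear form can stay away from `0` on far
blocks of the unit ball.

Suppose `w ∉ ℓ_N`, and suppose a continuous form exceeds `δ` in modulus while the arguments at a set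
`A` of positions escape to infinity. A vector of the ball has few coordinates above a given `η`, so
these arguments may be taken short (few nonzero coordinates) or flat (small coordinates). Weighting
the `k`-th of successive blocks by `w k` keeps the sums bounded, and signs can be chosen so that the
form takes a value of real part at least `δ ∑ w k ^ |A|` on them. This diverges, a contradiction
(`exists_norm_le_of_short_or_flat`, `exists_norm_le_of_tail`). Hence an `N`-homogeneous polynomial
is uniformly close on the ball to its compositions with coordinate projections
(`exists_norm_sub_proj_le`), which attain their norms by compactness.

Suppose `w ∈ ℓ_N`, let `M` be the least positive exponent with `w ∈ ℓ_M`, and let `q(x) = x(0)^(N-M)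
∑ x(i)^M`. If `p` of degree at most `N` is close to `q` and attains its norm at `x`, then `x + c
e_n` stays in the ball for small `c` and large `n` (`exists_norm_add_smul_single_le`). Expanding
`p(x + c e_n)` in powers of `c`, the coefficients of orders `1, …, M-1` tend to `0` by the first
argument, since `w ∉ ℓ_j` for `j < M`. The coefficient of order `M` is close to that of `q`, which
is `x(0)^(N-M) ≠ 0`. For small `c` of suitable phase this term increases the modulus of `p`, a
contradiction; so (ii) already fails for `k = N`. -/

/-! ### Partial sums and powers of an admissible sequence. -/

namespace AdmissibleSeq

variable (w : AdmissibleSeq)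

/-- The partial sums `W(n) = w 0 + ⋯ + w (n - 1)`. -/
noncomputable def partialSum (n : ℕ) : ℝ := ∑ i ∈ Finset.range n, w i

theorem partialSum_zero : w.partialSum 0 = 0 := by simp [partialSum]

theorem partialSum_succ (n : ℕ) : w.partialSum (n + 1) = w.partialSum n + w n :=
  Finset.sum_range_succ _ _

theorem partialSum_one : w.partialSum 1 = 1 := by simp [partialSum, w.zero']

theorem partialSum_mono : Monotone w.partialSum :=
  monotone_nat_of_le_succ fun n => by
    rw [partialSum_succ]; linarith [w.nonneg' n]

theorem partialSum_nonneg (n : ℕ) : 0 ≤ w.partialSum n :=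
  Finset.sum_nonneg fun i _ => w.nonneg' i

theorem one_le_partialSum {n : ℕ} (hn : n ≠ 0) : 1 ≤ w.partialSum n :=
  w.partialSum_one ▸ w.partialSum_mono (Nat.one_le_iff_ne_zero.mpr hn)

theorem le_one (n : ℕ) : w n ≤ 1 := w.zero' ▸ w.antitone' (Nat.zero_le n)

/-- A vanishing term makes all later terms vanish, so the partial sums would be eventually constant.
Positivity provides the room to perturb in `exists_norm_add_smul_single_le`. -/
theorem pos (n : ℕ) : 0 < w n := by
  by_contra h
  have h0 : w n = 0 := le_antisymm (not_lt.mp h) (w.nonneg' n)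
  have h1 : ∀ m, w.partialSum (m + n) = w.partialSum n := by
    intro m
    induction m with
    | zero => simp
    | succ m ih =>
      rw [show m + 1 + n = m + n + 1 by ring, partialSum_succ, ih]
      have := w.antitone' (show n ≤ m + n by omega)
      linarith [w.nonneg' (m + n)]
  have h2 : Tendsto (fun m => w.partialSum (m + n)) atTop atTop :=
    w.tendsto_sum'.comp (tendsto_add_atTop_nat n)
  simp only [h1] at h2
  exact not_tendsto_const_atTop _ _ h2

theorem tendsto_partialSum_div : Tendsto (fun n : ℕ => w.partialSum n / n) atTop (𝓝 0) := by
  have := w.tendsto_zero'.cesaro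
  refine this.congr fun n => ?_
  rw [partialSum, div_eq_inv_mul]

/-- Cesàro means of a null sequence are null. This limits the number of coordinates above `η` of a
vector in the unit ball. -/
theorem exists_partialSum_lt {η : ℝ} (hη : 0 < η) :
    ∃ m : ℕ, ∀ n, m < n → w.partialSum n < η * n := by
  obtain ⟨m, hm⟩ := eventually_atTop.mp (w.tendsto_partialSum_div.eventually_lt_const hη)
  refine ⟨m, fun n hn => ?_⟩
  have h0 : (0 : ℝ) < n := by exact_mod_cast (Nat.zero_le m).trans_lt hn
  exact (div_lt_iff₀ h0).mp (hm n hn.le)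

theorem summable_pow_of_le {m n : ℕ} (h : m ≤ n) (hs : Summable fun i => w i ^ m) :
    Summable fun i => w i ^ n :=
  hs.of_nonneg_of_le (fun i => pow_nonneg (w.nonneg' i) _)
    fun i => pow_le_pow_of_le_one (w.nonneg' i) (w.le_one i) h

theorem memlp_iff {N : ℕ} (hN : N ≠ 0) :
    Memℓp (fun i : ℕ => w i) (N : ENNReal) ↔ Summable fun i => w i ^ N := by
  rw [memℓp_gen_iff (by simpa using Nat.pos_of_ne_zero hN)]
  refine summable_congr fun i => ?_
  simp [abs_of_nonneg (w.nonneg' i)]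

end AdmissibleSeq

/-! ### Decreasing rearrangements and majorization. -/

section Rearrangement

variable {𝕜 : Type*} [RCLike 𝕜]

theorem decreasingRearrangement_antitone {x : ℕ → 𝕜}
    (hx : BddAbove (Set.range fun i => ‖x i‖)) : Antitone (decreasingRearrangement x) := by
  obtain ⟨C, hC⟩ := hx
  have hC' : ∀ i, ‖x i‖ ≤ C := fun i => hC ⟨i, rfl⟩
  intro m n hmn
  refine csInf_le_csInf ⟨0, fun t ht => ht.1⟩ ⟨C, (norm_nonneg _).trans (hC' 0), ?_⟩ ?_
  · have : {i | C < ‖x i‖} = ∅ := by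
      ext i; simp [hC' i]
    simp [this]
  · rintro t ⟨h0, ht⟩
    exact ⟨h0, ht.trans (by exact_mod_cast hmn)⟩

theorem decreasingRearrangement_le_of_norm_le {x y : ℕ → 𝕜}
    (hy : BddAbove (Set.range fun i => ‖y i‖)) (h : ∀ i, ‖x i‖ ≤ ‖y i‖) (n : ℕ) :
    decreasingRearrangement x n ≤ decreasingRearrangement y n := by
  obtain ⟨C, hC⟩ := hy
  have hC' : ∀ i, ‖y i‖ ≤ C := fun i => hC ⟨i, rfl⟩
  refine csInf_le_csInf ⟨0, fun t ht => ht.1⟩ ⟨C, (norm_nonneg _).trans (hC' 0), ?_⟩ ?_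
  · have : {i | C < ‖y i‖} = ∅ := by
      ext i; simp [hC' i]
    simp [this]
  · rintro t ⟨h0, ht⟩
    refine ⟨h0, (Set.encard_le_encard fun i hi => ?_).trans ht⟩
    exact lt_of_lt_of_le hi (h i)

/-- The smallest of the `n + 1` moduli lies below every `t` admissible in the infimum, since
otherwise more than `n` terms would exceed `t`. -/
theorem exists_norm_le_decreasingRearrangement {x : ℕ → 𝕜}
    (hx : BddAbove (Set.range fun i => ‖x i‖)) {n : ℕ} {A : Finset ℕ} (hA : A.card = n + 1) :
    ∃ j ∈ A, ‖x j‖ ≤ decreasingRearrangement x n := by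
  obtain ⟨j, hj, hmin⟩ := A.exists_min_image (fun i => ‖x i‖) (Finset.card_pos.mp (by omega))
  refine ⟨j, hj, ?_⟩
  obtain ⟨C, hC⟩ := hx
  have hC' : ∀ i, ‖x i‖ ≤ C := fun i => hC ⟨i, rfl⟩
  refine le_csInf ⟨C, (norm_nonneg _).trans (hC' 0), ?_⟩ ?_
  · have : {i | C < ‖x i‖} = ∅ := by
      ext i; simp [hC' i]
    simp [this]
  · rintro t ⟨_, ht⟩
    by_contra! hlt
    have hsub : (A : Set ℕ) ⊆ {i | t < ‖x i‖} := fun i hi => hlt.trans_le (hmin i hi)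
    have h1 := (Set.encard_le_encard hsub).trans ht
    rw [Set.encard_coe_eq_coe_finsetCard, hA] at h1
    have h2 : n + 1 ≤ n := by exact_mod_cast h1
    omega

theorem sum_pow_le_sum_decreasingRearrangement_pow {x : ℕ → 𝕜}
    (hx : BddAbove (Set.range fun i => ‖x i‖)) (M n : ℕ) (A : Finset ℕ) (hA : A.card = n) :
    ∑ i ∈ A, ‖x i‖ ^ M ≤ ∑ i ∈ Finset.range n, decreasingRearrangement x i ^ M := by
  induction n generalizing A with
  | zero => simp [Finset.card_eq_zero.mp hA]
  | succ n ih =>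
    obtain ⟨j, hj, hle⟩ := exists_norm_le_decreasingRearrangement hx hA
    rw [← Finset.sum_erase_add A _ hj, Finset.sum_range_succ]
    exact add_le_add (ih _ (by rw [Finset.card_erase_of_mem hj]; omega))
      (pow_le_pow_left₀ (norm_nonneg _) hle M)

/-- Abel summation: partial sums dominated by those of `b` stay dominated when weighted by a
decreasing nonnegative sequence. -/
theorem sum_mul_le_sum_mul_of_antitone {a b c : ℕ → ℝ} (hc : Antitone c) (hc0 : ∀ i, 0 ≤ c i)
    (h : ∀ n, ∑ i ∈ Finset.range n, a i ≤ ∑ i ∈ Finset.range n, b i) (n : ℕ) :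
    ∑ i ∈ Finset.range n, c i * a i ≤ ∑ i ∈ Finset.range n, c i * b i := by
  -- The boundary term of the summation by parts is kept for the induction; being nonnegative, it is
  -- dropped at the end.
  have key : ∀ n, c n * (∑ i ∈ Finset.range n, b i - ∑ i ∈ Finset.range n, a i) ≤
      ∑ i ∈ Finset.range n, c i * b i - ∑ i ∈ Finset.range n, c i * a i := by
    intro n
    induction n with
    | zero => simp
    | succ n ih =>
      have h1 := mul_le_mul_of_nonneg_right (hc (Nat.le_succ n)) (sub_nonneg.mpr (h (n + 1)))
      simp only [Finset.sum_range_succ] at h1 ⊢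
      simp only [Nat.succ_eq_add_one] at h1
      linarith
  have := mul_nonneg (hc0 n) (sub_nonneg.mpr (h n))
  linarith [key n]

/-- Factors `a i` are exchanged for `b i` one at a time: each exchange is Abel summation with the
decreasing weight `a i ^ k * b i ^ l`. -/
theorem sum_pow_le_sum_pow_of_sum_le {a b : ℕ → ℝ} (ha : Antitone a) (ha0 : ∀ i, 0 ≤ a i)
    (hb : Antitone b) (hb0 : ∀ i, 0 ≤ b i)
    (h : ∀ n, ∑ i ∈ Finset.range n, a i ≤ ∑ i ∈ Finset.range n, b i) (M n : ℕ) :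
    ∑ i ∈ Finset.range n, a i ^ M ≤ ∑ i ∈ Finset.range n, b i ^ M := by
  have anti : ∀ {c : ℕ → ℝ} (_ : Antitone c) (_ : ∀ i, 0 ≤ c i) (k : ℕ),
      Antitone fun i => c i ^ k :=
    fun hc hc0 k i j hij => pow_le_pow_left₀ (hc0 j) (hc hij) k
  have key : ∀ k l : ℕ, ∑ i ∈ Finset.range n, a i ^ k * b i ^ l ≤
      ∑ i ∈ Finset.range n, b i ^ (k + l) := by
    intro k
    induction k with
    | zero => simp
    | succ k ih =>
      intro l
      have h1 := sum_mul_le_sum_mul_of_antitone (c := fun i => a i ^ k * b i ^ l)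
        (fun i j hij => mul_le_mul (anti ha ha0 k hij) (anti hb hb0 l hij)
          (pow_nonneg (hb0 j) l) (pow_nonneg (ha0 i) k))
        (fun i => mul_nonneg (pow_nonneg (ha0 i) k) (pow_nonneg (hb0 i) l)) h n
      have h2 := ih (l + 1)
      calc _ = ∑ i ∈ Finset.range n, a i ^ k * b i ^ l * a i :=
            Finset.sum_congr rfl fun i _ => by ring
        _ ≤ _ := h1
        _ = ∑ i ∈ Finset.range n, a i ^ k * b i ^ (l + 1) :=
            Finset.sum_congr rfl fun i _ => by ring
        _ ≤ _ := h2
        _ = _ := by rw [show k + (l + 1) = k + 1 + l by ring]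
  simpa using key M 0

end Rearrangement

/-! ### Norm estimates, coordinate projections and unit vectors in `d_*(w,1)`. -/

namespace LorentzPredual

variable {𝕜 : Type*} [RCLike 𝕜] {w : AdmissibleSeq}

@[ext] theorem ext {x y : LorentzPredual 𝕜 w} (h : ∀ i, x i = y i) : x = y :=
  Subtype.ext (funext h)

@[simp] theorem add_apply (x y : LorentzPredual 𝕜 w) (i : ℕ) : (x + y) i = x i + y i := rfl
@[simp] theorem sub_apply (x y : LorentzPredual 𝕜 w) (i : ℕ) : (x - y) i = x i - y i := rfl
@[simp] theorem zero_apply (i : ℕ) : (0 : LorentzPredual 𝕜 w) i = 0 := rfl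
@[simp] theorem smul_apply (c : 𝕜) (x : LorentzPredual 𝕜 w) (i : ℕ) : (c • x) i = c * x i := rfl

theorem sum_decreasingRearrangement_le (x : LorentzPredual 𝕜 w) (n : ℕ) :
    ∑ i ∈ Finset.range n, decreasingRearrangement x i ≤ ‖x‖ * w.partialSum n := by
  cases n with
  | zero => simp [AdmissibleSeq.partialSum_zero]
  | succ n => exact (div_le_iff₀ (w.sum_pos n)).mp (le_ciSup x.bddAbove_ratio n)

theorem sum_norm_le (x : LorentzPredual 𝕜 w) (A : Finset ℕ) :
    ∑ i ∈ A, ‖x i‖ ≤ ‖x‖ * w.partialSum A.card :=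
  (sum_le_sum_decreasingRearrangement x.2.1 _ A rfl).trans (sum_decreasingRearrangement_le x _)

theorem norm_apply_le (x : LorentzPredual 𝕜 w) (i : ℕ) : ‖x i‖ ≤ ‖x‖ := by
  simpa [AdmissibleSeq.partialSum_one] using sum_norm_le x {i}

/-- Sums of the rearrangement are approximated by sums of moduli over finite sets of the same size.
With `sum_norm_le` this describes the norm by finite sets alone, without rearrangements. -/
theorem norm_le_of_sum_le (x : LorentzPredual 𝕜 w) {C : ℝ}
    (h : ∀ A : Finset ℕ, ∑ i ∈ A, ‖x i‖ ≤ C * w.partialSum A.card) : ‖x‖ ≤ C := by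
  refine ciSup_le fun n => (div_le_iff₀ (w.sum_pos n)).mpr ?_
  refine le_of_forall_pos_le_add fun ε hε => ?_
  obtain ⟨A, hA, hle⟩ := exists_sum_decreasingRearrangement_le x (n + 1)
    (show 0 < ε / (n + 1) by positivity)
  have h1 : ((n + 1 : ℕ) : ℝ) * (ε / (n + 1)) = ε := by
    push_cast; field_simp
  have h2 := h A
  rw [hA] at h2
  rw [h1] at hle
  exact hle.trans (by linarith [h2.trans_eq (by rfl : C * w.partialSum (n + 1) =
    C * ∑ i ∈ Finset.range (n + 1), w i)])

theorem exists_sum_norm_le (x : LorentzPredual 𝕜 w) {ε : ℝ} (hε : 0 < ε) :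
    ∃ k : ℕ, ∀ A : Finset ℕ, k ≤ A.card → ∑ i ∈ A, ‖x i‖ ≤ ε * w.partialSum A.card := by
  obtain ⟨k, hk⟩ := eventually_atTop.mp (x.2.2.eventually_lt_const hε)
  refine ⟨k + 1, fun A hA => ?_⟩
  obtain ⟨n, hn⟩ : ∃ n, A.card = n + 1 := ⟨A.card - 1, by omega⟩
  refine (sum_le_sum_decreasingRearrangement x.2.1 _ A hn).trans ?_
  rw [hn]
  exact (div_le_iff₀ (w.sum_pos n)).mp (hk n (by omega)).le

/-- A sequence dominated by an element of `d_*(w,1)` belongs to `d_*(w,1)`. -/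
theorem mem_of_norm_le (x : LorentzPredual 𝕜 w) {f : ℕ → 𝕜} (h : ∀ i, ‖f i‖ ≤ ‖x i‖) :
    f ∈ lorentzPredualSubmodule 𝕜 w := by
  refine ⟨?_, ?_⟩
  · obtain ⟨C, hC⟩ := x.2.1
    refine ⟨C, ?_⟩
    rintro _ ⟨i, rfl⟩
    exact (h i).trans (hC ⟨i, rfl⟩)
  · refine squeeze_zero (lorentzRatio_nonneg w _) (fun n => ?_) x.2.2
    exact div_le_div_of_nonneg_right
      (Finset.sum_le_sum fun i _ => decreasingRearrangement_le_of_norm_le x.2.1 h i)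
      (w.sum_pos n).le

theorem norm_le_of_norm_apply_le {x y : LorentzPredual 𝕜 w} (h : ∀ i, ‖x i‖ ≤ ‖y i‖) :
    ‖x‖ ≤ ‖y‖ :=
  norm_le_of_sum_le x fun A => (Finset.sum_le_sum fun i _ => h i).trans (sum_norm_le y A)

open Classical in
/-- The restriction of a sequence to a set of coordinates, as an operator on `d_*(w,1)`. -/
noncomputable def proj (s : Set ℕ) : LorentzPredual 𝕜 w →L[𝕜] LorentzPredual 𝕜 w :=
  LinearMap.mkContinuous
    { toFun := fun x => ⟨fun i => if i ∈ s then x i else 0, mem_of_norm_le x fun i => by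
        split_ifs <;> simp⟩
      map_add' := fun x y => by
        ext i
        change (if i ∈ s then (x + y) i else 0) =
          (if i ∈ s then x i else 0) + (if i ∈ s then y i else 0)
        split_ifs <;> simp
      map_smul' := fun c x => by
        ext i
        change (if i ∈ s then (c • x) i else 0) = c * (if i ∈ s then x i else 0)
        split_ifs <;> simp } 1 fun x => by
    rw [one_mul]
    refine norm_le_of_norm_apply_le fun i => ?_
    change ‖if i ∈ s then x i else 0‖ ≤ ‖x i‖
    split_ifs <;> simp

open Classical in
theorem proj_apply (s : Set ℕ) (x : LorentzPredual 𝕜 w) (i : ℕ) :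
    proj s x i = if i ∈ s then x i else 0 := rfl

theorem proj_apply_of_mem {s : Set ℕ} (x : LorentzPredual 𝕜 w) {i : ℕ} (hi : i ∈ s) :
    proj s x i = x i := by simp [proj_apply, hi]

theorem proj_apply_of_notMem {s : Set ℕ} (x : LorentzPredual 𝕜 w) {i : ℕ} (hi : i ∉ s) :
    proj s x i = 0 := by simp [proj_apply, hi]

theorem norm_proj_apply_le (s : Set ℕ) (x : LorentzPredual 𝕜 w) (i : ℕ) :
    ‖proj s x i‖ ≤ ‖x i‖ := by
  rw [proj_apply]; split_ifs <;> simp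

theorem norm_proj_le (s : Set ℕ) (x : LorentzPredual 𝕜 w) : ‖proj s x‖ ≤ ‖x‖ :=
  norm_le_of_norm_apply_le (norm_proj_apply_le s x)

theorem proj_add_proj_compl (s : Set ℕ) (x : LorentzPredual 𝕜 w) : proj s x + proj sᶜ x = x := by
  ext i
  by_cases hi : i ∈ s <;> simp [proj_apply, hi]

/-- The unit vectors of `d_*(w,1)`. -/
noncomputable def single (n : ℕ) : LorentzPredual 𝕜 w :=
  ⟨Pi.single n 1, by
    have hb : ∀ i, ‖(Pi.single n 1 : ℕ → 𝕜) i‖ ≤ 1 := fun i => by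
      by_cases h : i = n
      · subst h; simp
      · simp [h]
    have hs : ∀ A : Finset ℕ, ∑ i ∈ A, ‖(Pi.single n 1 : ℕ → 𝕜) i‖ ≤ 1 := fun A => by
      calc _ ≤ ∑ i ∈ A, if i = n then (1 : ℝ) else 0 := Finset.sum_le_sum fun i _ => by
            by_cases h : i = n
            · subst h; simp
            · simp [h]
        _ ≤ 1 := by rw [Finset.sum_ite_eq']; split_ifs <;> simp
    refine ⟨⟨1, by rintro _ ⟨i, rfl⟩; exact hb i⟩, ?_⟩
    have hW : Tendsto (fun k => 1 / ∑ i ∈ Finset.range (k + 1), w i) atTop (𝓝 0) :=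
      tendsto_const_nhds.div_atTop (w.tendsto_sum'.comp (tendsto_add_atTop_nat 1))
    refine squeeze_zero (lorentzRatio_nonneg w _) (fun k => ?_) hW
    refine div_le_div_of_nonneg_right ?_ (w.sum_pos k).le
    refine le_of_forall_pos_le_add fun ε hε => ?_
    obtain ⟨A, hA, hle⟩ := exists_sum_decreasingRearrangement_le (Pi.single n 1 : ℕ → 𝕜) (k + 1)
      (show 0 < ε / (k + 1) by positivity)
    have h1 : ((k + 1 : ℕ) : ℝ) * (ε / (k + 1)) = ε := by
      push_cast; field_simp
    linarith [hs A]⟩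

theorem single_apply (n i : ℕ) :
    (single n : LorentzPredual 𝕜 w) i = if i = n then 1 else 0 :=
  Pi.single_apply n 1 i

theorem norm_single_le (n : ℕ) : ‖(single n : LorentzPredual 𝕜 w)‖ ≤ 1 := by
  refine norm_le_of_sum_le _ fun A => ?_
  have h0 : ∀ i, ‖(single n : LorentzPredual 𝕜 w) i‖ = if i = n then 1 else 0 := fun i => by
    rw [single_apply]; split_ifs <;> simp
  simp only [h0, Finset.sum_ite_eq', one_mul]
  split_ifs with h
  · exact w.one_le_partialSum (Finset.card_ne_zero_of_mem h)
  · exact w.partialSum_nonneg _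

/-- The coordinate functionals, as linear maps. -/
def coord (i : ℕ) : LorentzPredual 𝕜 w →ₗ[𝕜] 𝕜 where
  toFun x := x i
  map_add' _ _ := rfl
  map_smul' _ _ := rfl

theorem sum_apply {ι : Type*} (s : Finset ι) (f : ι → LorentzPredual 𝕜 w) (i : ℕ) :
    (∑ k ∈ s, f k) i = ∑ k ∈ s, f k i :=
  map_sum (coord i) f s

theorem proj_Iio_eq_sum (n : ℕ) (x : LorentzPredual 𝕜 w) :
    proj (Set.Iio n) x = ∑ i ∈ Finset.range n, x i • single i := by
  ext k
  rw [sum_apply, proj_apply]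
  simp [single_apply]

/-- Elements of the unit ball have a controlled number of large coordinates. -/
theorem exists_finset_card_le (w : AdmissibleSeq) {η : ℝ} (hη : 0 < η) :
    ∃ m : ℕ, ∀ x : LorentzPredual 𝕜 w, ‖x‖ ≤ 1 →
      ∃ F : Finset ℕ, F.card ≤ m ∧ ∀ i ∉ F, ‖x i‖ ≤ η := by
  obtain ⟨m, hm⟩ := w.exists_partialSum_lt hη
  refine ⟨m, fun x hx => ?_⟩
  -- A set of `n > m` coordinates above `η` would have sum at least `η * n`, which exceeds `W(n)`.
  have hcard : ∀ A : Finset ℕ, (∀ i ∈ A, η < ‖x i‖) → A.card ≤ m := by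
    intro A hA
    by_contra! hlt
    have h1 := A.card_nsmul_le_sum (fun i => ‖x i‖) η fun i hi => (hA i hi).le
    have h2 := sum_norm_le x A
    have h3 := mul_le_mul_of_nonneg_right hx (w.partialSum_nonneg A.card)
    have h4 := hm _ hlt
    rw [nsmul_eq_mul] at h1
    linarith
  have hfin : {i | η < ‖x i‖}.Finite := by
    by_contra hinf
    obtain ⟨A, hA, hc⟩ := Set.Infinite.exists_subset_card_eq hinf (m + 1)
    have := hcard A fun i hi => hA hi
    omega
  refine ⟨hfin.toFinset, hcard _ fun i hi => by simpa using hi, fun i hi => ?_⟩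
  simpa using hi

theorem tendsto_apply_zero (x : LorentzPredual 𝕜 w) : Tendsto (fun i => x i) atTop (𝓝 0) := by
  have key : ∀ y : LorentzPredual 𝕜 w, ‖y‖ ≤ 1 → Tendsto (fun i => y i) atTop (𝓝 0) := by
    intro y hy
    refine NormedAddGroup.tendsto_nhds_zero.mpr fun ε hε => ?_
    obtain ⟨m, hm⟩ := exists_finset_card_le (𝕜 := 𝕜) w (half_pos hε)
    obtain ⟨F, -, hF⟩ := hm y hy
    refine eventually_atTop.mpr ⟨F.sup id + 1, fun i hi => ?_⟩
    have hiF : i ∉ F := fun h => by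
      have : i ≤ F.sup id := Finset.le_sup (f := id) h
      omega
    linarith [hF i hiF]
  have h0 : (0 : ℝ) < ‖x‖ + 1 := by positivity
  have h1 : ((‖x‖ + 1 : ℝ) : 𝕜) ≠ 0 := by exact_mod_cast h0.ne'
  have h2 := (key (((‖x‖ + 1 : ℝ) : 𝕜)⁻¹ • x) (by
    rw [norm_smul, norm_inv, RCLike.norm_ofReal, abs_of_pos h0, inv_mul_le_iff₀ h0]
    linarith)).const_mul ((‖x‖ + 1 : ℝ) : 𝕜)
  rw [mul_zero] at h2
  refine h2.congr fun i => ?_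
  rw [smul_apply, mul_inv_cancel_left₀ h1]

/-- The finitely supported sequences approximate: the tails of an element of `d_*(w,1)` tend
to `0`. -/
theorem tendsto_proj_Iio (x : LorentzPredual 𝕜 w) :
    Tendsto (fun n => proj (Set.Iio n) x) atTop (𝓝 x) := by
  refine Metric.tendsto_atTop.mpr fun ε hε => ?_
  obtain ⟨k, hk⟩ := exists_sum_norm_le x (half_pos hε)
  have hk0 : (0 : ℝ) < k + 1 := by positivity
  obtain ⟨n, hn⟩ := eventually_atTop.mp (NormedAddGroup.tendsto_nhds_zero.mp
    (tendsto_apply_zero x) (ε / 2 / (k + 1)) (by positivity))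
  refine ⟨n, fun m hm => ?_⟩
  rw [dist_comm, dist_eq_norm]
  refine lt_of_le_of_lt (norm_le_of_sum_le _ (C := ε / 2) fun A => ?_) (half_lt_self hε)
  have hle : ∀ i, ‖(x - proj (Set.Iio m) x) i‖ ≤ ‖x i‖ ∧
      ‖(x - proj (Set.Iio m) x) i‖ ≤ ε / 2 / (k + 1) := by
    intro i
    by_cases hi : i < m
    · have h0 : (0 : ℝ) ≤ ε / 2 / (k + 1) := by positivity
      simp only [sub_apply, proj_apply_of_mem x (show i ∈ Set.Iio m from hi), sub_self, norm_zero]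
      exact ⟨norm_nonneg _, h0⟩
    · rw [sub_apply, proj_apply_of_notMem x (by simpa using hi), sub_zero]
      exact ⟨le_rfl, (hn i (by omega)).le⟩
  -- Large sets are handled by the condition defining `d_*(w,1)`. A smaller set has fewer than `k`
  -- coordinates, each at most `ε / 2 / (k + 1)`, and `W ≥ 1` on nonempty sets.
  rcases le_or_gt k A.card with h | h
  · exact (Finset.sum_le_sum fun i _ => (hle i).1).trans (hk A h)
  · rcases Nat.eq_zero_or_pos A.card with h0 | h0
    · simp [Finset.card_eq_zero.mp h0, AdmissibleSeq.partialSum_zero]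
    · have h1 := A.sum_le_card_nsmul _ _ fun i _ => (hle i).2
      rw [nsmul_eq_mul] at h1
      have h2 : (A.card : ℝ) ≤ k + 1 := by exact_mod_cast (by omega : A.card ≤ k + 1)
      have h3 : (A.card : ℝ) * (ε / 2 / (k + 1)) ≤ ε / 2 := by
        rw [mul_div_assoc', div_le_iff₀ hk0]; nlinarith
      have h4 := mul_le_mul_of_nonneg_left (w.one_le_partialSum h0.ne') (half_pos hε).le
      linarith

/-- No point of the unit ball is rigid in the direction of far unit vectors. -/
theorem exists_norm_add_smul_single_le (x : LorentzPredual 𝕜 w) (hx : ‖x‖ ≤ 1) :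
    ∃ δ > 0, ∃ n₀, ∀ n ≥ n₀, ∀ c : 𝕜, ‖c‖ ≤ δ → ‖x + c • single n‖ ≤ 1 := by
  obtain ⟨k, hk⟩ := exists_sum_norm_le x (half_pos one_pos)
  have hwk := w.pos k
  obtain ⟨n₀, hn₀⟩ := eventually_atTop.mp (NormedAddGroup.tendsto_nhds_zero.mp
    (tendsto_apply_zero x) (w k / 2) (by positivity))
  -- On sets of at least `k` indices the sums for `x` are at most `W / 2`, so there is slack `1 /
  -- 2`. On a smaller set containing `n`, the new coordinate is at most `w k / 2 + w k / 2`, hence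
  -- at most the last increment of `W`.
  refine ⟨w k / 2, by positivity, n₀, fun n hn c hc => norm_le_of_sum_le _ fun A => ?_⟩
  have hne : ∀ i, i ≠ n → (x + c • (single n : LorentzPredual 𝕜 w)) i = x i := fun i hi => by
    simp [single_apply, hi]
  have hen : ‖(x + c • (single n : LorentzPredual 𝕜 w)) n‖ ≤ ‖x n‖ + ‖c‖ := by
    simpa [single_apply] using norm_add_le (x n) c
  generalize x + c • (single n : LorentzPredual 𝕜 w) = y at hne hen ⊢
  rw [one_mul]
  have hball : ∀ B : Finset ℕ, ∑ i ∈ B, ‖x i‖ ≤ w.partialSum B.card := fun B =>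
    (sum_norm_le x B).trans (mul_le_of_le_one_left (w.partialSum_nonneg _) hx)
  by_cases hnA : n ∈ A
  · have hsum : ∑ i ∈ A.erase n, ‖y i‖ = ∑ i ∈ A.erase n, ‖x i‖ :=
      Finset.sum_congr rfl fun i hi => congrArg _ (hne i (Finset.ne_of_mem_erase hi))
    rw [← Finset.sum_erase_add A _ hnA, hsum]
    have hpos := Finset.card_pos.mpr ⟨n, hnA⟩
    rcases le_or_gt k A.card with h | h
    · have h1 := hk A h
      rw [← Finset.sum_erase_add A _ hnA] at h1
      have h2 := w.one_le_partialSum hpos.ne'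
      have h3 := w.le_one k
      linarith
    · have h1 := hball (A.erase n)
      rw [Finset.card_erase_of_mem hnA] at h1
      have h2 := w.partialSum_succ (A.card - 1)
      rw [Nat.sub_add_cancel hpos] at h2
      have h3 := w.antitone' (show A.card - 1 ≤ k by omega)
      linarith [hn₀ n hn]
  · exact (Finset.sum_congr rfl fun i hi =>
      congrArg _ (hne i fun h => hnA (h ▸ hi))).trans_le (hball A)

/-- In the unit ball the rearrangement is majorized by `w`, and majorization passes to powers. Hence
`d_*(w,1) ⊆ ℓ_M` when `w ∈ ℓ_M`. -/
theorem sum_norm_pow_le (x : LorentzPredual 𝕜 w) (hx : ‖x‖ ≤ 1) (M : ℕ) (A : Finset ℕ) :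
    ∑ i ∈ A, ‖x i‖ ^ M ≤ ∑ i ∈ Finset.range A.card, w i ^ M :=
  (sum_pow_le_sum_decreasingRearrangement_pow x.2.1 M _ A rfl).trans
    (sum_pow_le_sum_pow_of_sum_le (decreasingRearrangement_antitone x.2.1)
      (decreasingRearrangement_nonneg _) w.antitone' w.nonneg'
      (fun n => (sum_decreasingRearrangement_le x n).trans
        (mul_le_of_le_one_left (w.partialSum_nonneg n) hx)) M _)

end LorentzPredual

/-! ### Multilinear forms on sums of far blocks. -/

/-- Choice of signs in a multilinear form: the mixed terms can be made to help. -/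
theorem MultilinearMap.exists_sign {𝕜 ι E : Type*} [RCLike 𝕜] [DecidableEq ι]
    [AddCommGroup E] [Module 𝕜 E] (Φ : MultilinearMap 𝕜 (fun _ : ι => E) 𝕜) {A : Finset ι}
    (hA : A.Nonempty) :
    ∀ (x y : ι → E), (∀ j ∉ A, x j = y j) → ∀ σ : 𝕜, (σ = 1 ∨ σ = -1) →
      ∃ θ : ι → 𝕜, (∀ j, θ j = 1 ∨ θ j = -1) ∧
        RCLike.re (Φ x + σ * Φ y) ≤
          RCLike.re (Φ fun j => if j ∈ A then x j + θ j • y j else x j) := by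
  induction hA using Finset.Nonempty.cons_induction with
  | singleton a =>
    intro x y hxy σ hσ
    refine ⟨fun _ => σ, fun _ => hσ, le_of_eq ?_⟩
    have h1 : (fun j => if j ∈ ({a} : Finset ι) then x j + σ • y j else x j) =
        Function.update x a (x a + σ • y a) := by
      ext j
      by_cases h : j = a
      · subst h; simp
      · simp [h]
    have h2 : Function.update x a (y a) = y := by
      ext j
      by_cases h : j = a
      · subst h; simp
      · simp [h, hxy j (by simpa using h)]
    rw [h1, Φ.map_update_add, Φ.map_update_smul, Function.update_eq_self, h2, smul_eq_mul]
  | cons a A ha hA ih =>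
    intro x y hxy σ hσ
    -- `z` collects the terms mixed at position `a`. With `x a + τ • y a` placed in both families
    -- and the sign `σ * τ` passed to the induction, `τ * τ = 1` restores `σ * Φ y` and leaves `τ *
    -- z`, whose real part is nonnegative.
    set z : 𝕜 := Φ (Function.update x a (y a)) + σ * Φ (Function.update y a (x a)) with hz
    obtain ⟨τ, hτ, hτz⟩ : ∃ τ : 𝕜, (τ = 1 ∨ τ = -1) ∧ 0 ≤ RCLike.re (τ * z) := by
      rcases le_total 0 (RCLike.re z) with h | h
      · exact ⟨1, Or.inl rfl, by simpa using h⟩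
      · exact ⟨-1, Or.inr rfl, by simpa using h⟩
    have hτ2 : τ * τ = 1 := by rcases hτ with rfl | rfl <;> simp
    obtain ⟨θ, hθ, hle⟩ := ih (Function.update x a (x a + τ • y a))
      (Function.update y a (x a + τ • y a)) (fun j hj => by
        by_cases h : j = a
        · subst h; simp
        · simp [h, hxy j (by simp [h, hj])]) (σ * τ) (by
        rcases hσ with rfl | rfl <;> rcases hτ with rfl | rfl <;> simp)
    refine ⟨Function.update θ a τ, fun j => ?_, ?_⟩
    · by_cases h : j = a
      · subst h; simpa using hτ
      · simpa [h] using hθ j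
    · have h1 : (fun j => if j ∈ Finset.cons a A ha then x j + Function.update θ a τ j • y j
          else x j) = fun j => if j ∈ A then Function.update x a (x a + τ • y a) j +
            θ j • Function.update y a (x a + τ • y a) j else
              Function.update x a (x a + τ • y a) j := by
        ext j
        by_cases h : j = a
        · subst h; simp [ha]
        · simp [h]
      rw [h1]
      refine le_trans ?_ hle
      simp only [Φ.map_update_add, Φ.map_update_smul, Function.update_eq_self, smul_eq_mul]
      have h2 : Φ x + τ * Φ (Function.update x a (y a)) +
          σ * τ * (Φ (Function.update y a (x a)) + τ * Φ y) = Φ x + σ * Φ y + τ * z := by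
        rw [hz]
        linear_combination (σ * Φ y) * hτ2
      rw [h2, map_add _ (Φ x + σ * Φ y)]
      linarith

namespace LorentzPredual

variable {𝕜 : Type*} [RCLike 𝕜] {w : AdmissibleSeq}

theorem sum_norm_add_of_disjoint {x y : LorentzPredual 𝕜 w} {M : ℕ} (hx : ∀ i, M ≤ i → x i = 0)
    (hy : ∀ i < M, y i = 0) (B : Finset ℕ) :
    ∑ i ∈ B, ‖(x + y) i‖ =
      ∑ i ∈ B.filter (· < M), ‖x i‖ + ∑ i ∈ B.filter (¬ · < M), ‖y i‖ := by
  rw [← Finset.sum_filter_add_sum_filter_not B (· < M)]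
  congr 1
  · refine Finset.sum_congr rfl fun i hi => ?_
    rw [add_apply, hy i (Finset.mem_filter.mp hi).2, add_zero]
  · refine Finset.sum_congr rfl fun i hi => ?_
    rw [add_apply, hx i (not_lt.mp (Finset.mem_filter.mp hi).2), zero_add]

/-- Adding a weighted short block to a sum of short blocks. -/
theorem sum_norm_add_smul_le {x y : LorentzPredual 𝕜 w} {M K m : ℕ}
    (hx : ∀ i, M ≤ i → x i = 0) (hy : ∀ i < M, y i = 0) (hy1 : ‖y‖ ≤ 1)
    {F : Finset ℕ} (hF : F.card ≤ m) (hyF : ∀ i ∉ F, y i = 0) {c : 𝕜} (hc : ‖c‖ ≤ w K)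
    (h : ∀ B : Finset ℕ, ∑ i ∈ B, ‖x i‖ ≤ m * w.partialSum (min B.card K)) (B : Finset ℕ) :
    ∑ i ∈ B, ‖(x + c • y) i‖ ≤ m * w.partialSum (min B.card (K + 1)) := by
  rw [sum_norm_add_of_disjoint hx (fun i hi => by rw [smul_apply, hy i hi, mul_zero])]
  have hcard := B.card_filter_add_card_filter_not (· < M)
  set B₁ := B.filter (· < M)
  set B₂ := B.filter (¬ · < M)
  have hm : (0 : ℝ) ≤ m := Nat.cast_nonneg m
  have h1 := h B₁
  have h2 : ∑ i ∈ B₂, ‖(c • y) i‖ ≤ m * w K := by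
    have hz : ∀ i ∈ B₂, i ∉ B₂ ∩ F → ‖(c • y) i‖ = 0 := fun i hi hiF => by
      have : i ∉ F := fun h => hiF (Finset.mem_inter.mpr ⟨hi, h⟩)
      rw [smul_apply, hyF i this, mul_zero, norm_zero]
    rw [← Finset.sum_subset Finset.inter_subset_left hz]
    have h3 : ∀ i, ‖(c • y) i‖ ≤ w K := fun i => by
      rw [smul_apply, norm_mul]
      exact (mul_le_of_le_one_right (norm_nonneg c) ((norm_apply_le y i).trans hy1)).trans hc
    have h4 := (B₂ ∩ F).sum_le_card_nsmul _ _ fun i _ => h3 i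
    rw [nsmul_eq_mul] at h4
    refine h4.trans (mul_le_mul_of_nonneg_right ?_ (w.nonneg' K))
    exact_mod_cast (Finset.card_le_card Finset.inter_subset_right).trans hF
  rcases Nat.eq_zero_or_pos B₂.card with h0 | h0
  · rw [Finset.card_eq_zero.mp h0, Finset.sum_empty, add_zero]
    exact h1.trans (mul_le_mul_of_nonneg_left (w.partialSum_mono (by omega)) hm)
  -- As `B` meets the new block, `B₁` has fewer elements than `B`. One more increment of `W` is
  -- therefore available, and it is at least `w K` because `w` decreases.
  · have h5 : w.partialSum (min B₁.card K) + w K ≤ w.partialSum (min B.card (K + 1)) := by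
      have h6 := w.antitone' (min_le_right B₁.card K)
      have h7 := w.partialSum_succ (min B₁.card K)
      have h8 := w.partialSum_mono (show min B₁.card K + 1 ≤ min B.card (K + 1) by omega)
      linarith
    have := mul_le_mul_of_nonneg_left h5 hm
    linarith

/-- Adding a flat block to a finitely supported vector of norm less than `2`. -/
theorem exists_norm_add_lt_two (x : LorentzPredual 𝕜 w) {M : ℕ} (hx : ∀ i, M ≤ i → x i = 0)
    (hx2 : ‖x‖ < 2) :
    ∃ η > 0, ∀ y : LorentzPredual 𝕜 w, (∀ i < M, y i = 0) → ‖y‖ ≤ 1 → (∀ i, ‖y i‖ ≤ η) →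
      ‖x + y‖ < 2 := by
  set c := max 1 ‖x‖ with hc
  have hc1 : 1 ≤ c := le_max_left _ _
  have hc2 : c < 2 := max_lt one_lt_two hx2
  set ε := (2 - c) / 2 with hε
  have hε0 : 0 < ε := by rw [hε]; linarith
  -- Once `B` has `b₀` indices in the new block, the whole sum for `x`, at most `c * W(M)`, is
  -- absorbed by `ε * W`. With fewer indices, the flat block itself contributes at most `ε`.
  obtain ⟨b₀, hb₀⟩ := eventually_atTop.mp
    (w.tendsto_sum'.eventually_ge_atTop (c * w.partialSum M / ε))
  have hb1 : (0 : ℝ) < b₀ + 1 := by positivity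
  refine ⟨ε / (b₀ + 1), by positivity, fun y hy hy1 hyη => ?_⟩
  refine lt_of_le_of_lt (norm_le_of_sum_le _ (C := c + ε) fun B => ?_) (by rw [hε]; linarith)
  rw [sum_norm_add_of_disjoint hx hy]
  have hcard := B.card_filter_add_card_filter_not (· < M)
  have hB₁ : (B.filter (· < M)).card ≤ M := by
    have : B.filter (· < M) ⊆ Finset.range M := fun i hi => by
      simpa using (Finset.mem_filter.mp hi).2
    simpa using Finset.card_le_card this
  set B₁ := B.filter (· < M)
  set B₂ := B.filter (¬ · < M)
  have h1 : ∑ i ∈ B₁, ‖x i‖ ≤ c * w.partialSum B₁.card :=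
    (sum_norm_le x B₁).trans
      (mul_le_mul_of_nonneg_right (le_max_right _ _) (w.partialSum_nonneg _))
  have h2 : ∑ i ∈ B₂, ‖y i‖ ≤ w.partialSum B₂.card :=
    (sum_norm_le y B₂).trans (mul_le_of_le_one_left (w.partialSum_nonneg _) hy1)
  have hW := w.partialSum_nonneg B.card
  rcases le_or_gt b₀ B₂.card with hb | hb
  · have h3 := hb₀ _ hb
    rw [div_le_iff₀ hε0] at h3
    change _ ≤ w.partialSum _ * ε at h3
    have h4 := mul_le_mul_of_nonneg_left (w.partialSum_mono hB₁) (by linarith : 0 ≤ c)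
    have h5 := w.partialSum_mono (show B₂.card ≤ B.card by omega)
    nlinarith [w.partialSum_nonneg B₂.card]
  · have h3 := mul_le_mul_of_nonneg_left
      (w.partialSum_mono (show B₁.card ≤ B.card by omega)) (by linarith : 0 ≤ c)
    have h4 : ∑ i ∈ B₂, ‖y i‖ ≤ ε * w.partialSum B.card := by
      rcases Nat.eq_zero_or_pos B₂.card with h0 | h0
      · rw [Finset.card_eq_zero.mp h0, Finset.sum_empty]
        positivity
      · have h5 := B₂.sum_le_card_nsmul _ _ fun i _ => hyη i
        rw [nsmul_eq_mul] at h5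
        have h6 : (B₂.card : ℝ) ≤ b₀ + 1 := by exact_mod_cast (by omega : B₂.card ≤ b₀ + 1)
        have h7 : (B₂.card : ℝ) * (ε / (b₀ + 1)) ≤ ε := by
          rw [mul_div_assoc', div_le_iff₀ hb1]; nlinarith
        have h8 := mul_le_mul_of_nonneg_left
          (w.one_le_partialSum (show B.card ≠ 0 by omega)) hε0.le
        linarith
    linarith

/-- Tails tend to `0` in norm and `Φ` is continuous. Finite supports allow the next block to be
placed beyond all the previous ones. -/
theorem exists_truncation {ι : Type*} [DecidableEq ι]
    {Φ : ContinuousMultilinearMap 𝕜 (fun _ : ι => LorentzPredual 𝕜 w) 𝕜}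
    (A : Finset ι) {u : ι → LorentzPredual 𝕜 w} {δ : ℝ} (h : δ < ‖Φ u‖) :
    ∃ M, δ < ‖Φ fun j => if j ∈ A then proj (Set.Iio M) (u j) else u j‖ := by
  have h1 : Tendsto (fun (M : ℕ) j => if j ∈ A then proj (Set.Iio M) (u j) else u j)
      atTop (𝓝 u) := by
    refine tendsto_pi_nhds.mpr fun j => ?_
    by_cases hj : j ∈ A
    · simpa [hj] using tendsto_proj_Iio (u j)
    · simp [hj]
  exact (((Φ.cont.norm.tendsto u).comp h1).eventually_const_lt h).exists

variable {ι : Type*} [Fintype ι] [DecidableEq ι]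

/-- If `w ∉ ℓ_|A|`, a continuous multilinear form is small when the arguments in `A` are far
blocks of the unit ball, each either short (for positions in `S`) or flat. -/
theorem exists_norm_le_of_short_or_flat
    (Φ : ContinuousMultilinearMap 𝕜 (fun _ : ι => LorentzPredual 𝕜 w) 𝕜)
    {A : Finset ι} (hA : A.Nonempty) (hw : ¬ Summable fun i => w i ^ A.card)
    (g : ι → LorentzPredual 𝕜 w) (S : Finset ι) (m : ℕ) {δ : ℝ} (hδ : 0 < δ) :
    ∃ η > 0, ∃ n : ℕ, ∀ u : ι → LorentzPredual 𝕜 w, (∀ j ∉ A, u j = g j) →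
      (∀ j ∈ A, ‖u j‖ ≤ 1) → (∀ j ∈ A, ∀ i < n, u j i = 0) →
      (∀ j ∈ A, j ∈ S → ∃ F : Finset ℕ, F.card ≤ m ∧ ∀ i ∉ F, u j i = 0) →
      (∀ j ∈ A, j ∉ S → ∀ i, ‖u j i‖ ≤ η) → ‖Φ u‖ ≤ δ := by
  by_contra! hcon
  -- `x` is a sum of `K` successive blocks with weights `w 0, …, w (K - 1)` at the positions of `A`:
  -- bounded by `m` at short positions and by `2` at flat ones, while `Φ x` grows with `∑ w k ^
  -- |A|`.
  have build : ∀ K : ℕ, ∃ x : ι → LorentzPredual 𝕜 w, (∀ j ∉ A, x j = g j) ∧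
      (∃ M : ℕ, ∀ j ∈ A, ∀ i, M ≤ i → x j i = 0) ∧
      (∀ j ∈ A, j ∈ S → ∀ B : Finset ℕ,
        ∑ i ∈ B, ‖x j i‖ ≤ m * w.partialSum (min B.card K)) ∧
      (∀ j ∈ A, j ∉ S → ‖x j‖ < 2) ∧
      δ * ∑ k ∈ Finset.range K, w k ^ A.card ≤ RCLike.re (Φ x) := by
    intro K
    induction K with
    | zero =>
      refine ⟨fun j => if j ∈ A then 0 else g j, fun j hj => by simp [hj],
        ⟨0, fun j hj i _ => by simp [hj]⟩, fun j hj _ B => ?_, fun j hj _ => by simp [hj], ?_⟩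
      · simp [hj, AdmissibleSeq.partialSum_zero]
      · obtain ⟨a, ha⟩ := hA
        rw [Φ.map_coord_zero a (by simp [ha])]
        simp
    | succ K ih =>
      obtain ⟨x, hxg, ⟨M, hM⟩, hxS, hxZ, hxΦ⟩ := ih
      have hη : ∀ j, ∃ η > 0, j ∈ A → j ∉ S → ∀ y : LorentzPredual 𝕜 w,
          (∀ i < M, y i = 0) → ‖y‖ ≤ 1 → (∀ i, ‖y i‖ ≤ η) → ‖x j + y‖ < 2 := by
        intro j
        by_cases hj : j ∈ A ∧ j ∉ S
        · obtain ⟨η, h0, h⟩ := exists_norm_add_lt_two (x j) (hM j hj.1) (hxZ j hj.1 hj.2)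
          exact ⟨η, h0, fun _ _ => h⟩
        · exact ⟨1, one_pos, fun h1 h2 => absurd ⟨h1, h2⟩ hj⟩
      choose η hη0 hη using hη
      obtain ⟨u, hug, hu1, hut, huS, huZ, huΦ⟩ := hcon (A.inf' hA η)
        ((Finset.lt_inf'_iff hA).mpr fun j _ => hη0 j) M
      obtain ⟨M', hM'⟩ := exists_truncation A huΦ
      set v : ι → LorentzPredual 𝕜 w :=
        fun j => if j ∈ A then proj (Set.Iio M') (u j) else u j with hv
      have hvle : ∀ j i, ‖v j i‖ ≤ ‖u j i‖ := fun j i => by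
        by_cases hj : j ∈ A
        · simpa [hv, hj] using norm_proj_apply_le _ (u j) i
        · simp [hv, hj]
      have hvz : ∀ j i, u j i = 0 → v j i = 0 := fun j i h => by
        simpa [h] using hvle j i
      have hv1 : ∀ j ∈ A, ‖v j‖ ≤ 1 := fun j hj =>
        (norm_le_of_norm_apply_le (hvle j)).trans (hu1 j hj)
      obtain ⟨a, ha⟩ := hA
      -- The phase of `Φ v` is corrected in the single argument `a`; the factors `w K` in all
      -- arguments of `A` produce `w K ^ |A|`.
      obtain ⟨ξ, hξ, hξΦ⟩ := RCLike.exists_norm_eq_mul_self (Φ v)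
      set s : ι → 𝕜 := fun j => if j ∈ A then (w K : 𝕜) * (if j = a then ξ else 1) else 1 with hs
      have hsn : ∀ j ∈ A, ‖s j‖ = w K := fun j hj => by
        have : ‖(if j = a then ξ else 1 : 𝕜)‖ = 1 := by split_ifs <;> simp [hξ]
        simp only [hs, hj, if_true]
        rw [norm_mul, this, mul_one, RCLike.norm_ofReal, abs_of_nonneg (w.nonneg' K)]
      have hsprod : ∏ j, s j = (w K : 𝕜) ^ A.card * ξ := by
        simp only [hs]
        rw [Finset.prod_ite_mem, Finset.univ_inter, Finset.prod_mul_distrib, Finset.prod_const,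
          Finset.prod_ite_eq' A a, if_pos ha]
      obtain ⟨θ, hθ, hle⟩ := Φ.toMultilinearMap.exists_sign ⟨a, ha⟩ x (fun j => s j • v j)
        (fun j hj => by simp [hs, hv, hj, hxg j hj, hug j hj]) 1 (Or.inl rfl)
      have hθn : ∀ j, ‖θ j‖ = 1 := fun j => by rcases hθ j with h | h <;> simp [h]
      have hcn : ∀ j ∈ A, ‖θ j * s j‖ = w K := fun j hj => by
        rw [norm_mul, hθn, hsn j hj, one_mul]
      refine ⟨fun j => if j ∈ A then x j + θ j • s j • v j else x j,
        fun j hj => by simp [hj, hxg j hj], ⟨max M M', fun j hj i hi => ?_⟩,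
        fun j hj hjS => ?_, fun j hj hjS => ?_, ?_⟩
      · have h1 : v j i = 0 := by
          simp only [hv, hj, if_true]
          exact proj_apply_of_notMem _ (by
            have := (le_max_right M M').trans hi
            simpa using this)
        simp [hj, hM j hj i ((le_max_left _ _).trans hi), h1]
      · obtain ⟨F, hF, hFz⟩ := huS j hj hjS
        simp only [hj, if_true, smul_smul]
        exact sum_norm_add_smul_le (hM j hj) (fun i hi => hvz j i (hut j hj i hi)) (hv1 j hj) hF
          (fun i hi => hvz j i (hFz i hi)) (hcn j hj).le (hxS j hj hjS)
      · simp only [hj, if_true, smul_smul]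
        have hc1 : ‖θ j * s j‖ ≤ 1 := (hcn j hj).trans_le (w.le_one K)
        refine hη j hj hjS _ (fun i hi => ?_) ?_ fun i => ?_
        · rw [smul_apply, hvz j i (hut j hj i hi), mul_zero]
        · rw [norm_smul]
          exact mul_le_one₀ hc1 (norm_nonneg _) (hv1 j hj)
        · rw [smul_apply, norm_mul]
          exact (mul_le_of_le_one_left (norm_nonneg _) hc1).trans
            ((hvle j i).trans ((huZ j hj hjS i).trans (Finset.inf'_le _ hj)))
      · refine le_trans ?_ hle
        have h1 : Φ.toMultilinearMap (fun j => s j • v j) =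
            ((w K ^ A.card * ‖Φ v‖ : ℝ) : 𝕜) := by
          rw [Φ.toMultilinearMap.map_smul_univ, hsprod, smul_eq_mul, mul_assoc,
            RCLike.ofReal_mul, RCLike.ofReal_pow]
          exact congrArg _ hξΦ.symm
        rw [h1, one_mul, map_add, RCLike.ofReal_re, Finset.sum_range_succ, mul_add]
        refine add_le_add hxΦ ?_
        rw [mul_comm]
        exact mul_le_mul_of_nonneg_left hM'.le (pow_nonneg (w.nonneg' K) _)
  have hlim := (not_summable_iff_tendsto_nat_atTop_of_nonneg
    fun i => pow_nonneg (w.nonneg' i) A.card).mp hw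
  -- The norms of the `x j` are bounded independently of `K`, so divergence of the series
  -- contradicts the bound by `‖Φ‖`.
  obtain ⟨K, hK⟩ := (hlim.eventually_gt_atTop
    (‖Φ‖ * (∏ j, (m + 2 + ‖g j‖)) / δ)).exists
  obtain ⟨x, hxg, -, hxS, hxZ, hxΦ⟩ := build K
  have hm : (0 : ℝ) ≤ m := Nat.cast_nonneg m
  have hxn : ∀ j, ‖x j‖ ≤ m + 2 + ‖g j‖ := by
    intro j
    have hg := norm_nonneg (g j)
    by_cases hj : j ∈ A
    · by_cases hjS : j ∈ S
      · have : ‖x j‖ ≤ m := norm_le_of_sum_le _ fun B => (hxS j hj hjS B).trans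
          (mul_le_mul_of_nonneg_left (w.partialSum_mono (min_le_left _ _)) hm)
        linarith
      · linarith [hxZ j hj hjS]
    · rw [hxg j hj]; linarith
  have h1 := (RCLike.re_le_norm (Φ x)).trans (Φ.le_opNorm x)
  have h2 := mul_le_mul_of_nonneg_left
    (Finset.prod_le_prod (s := Finset.univ) (fun j _ => norm_nonneg (x j)) fun j _ => hxn j)
    (norm_nonneg Φ)
  rw [div_lt_iff₀ hδ] at hK
  linarith

end LorentzPredual

/-! ### Forms vanishing at infinity, and approximation through finitely many coordinates. -/

namespace LorentzPredual

variable {𝕜 : Type*} [RCLike 𝕜] {w : AdmissibleSeq}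
variable {ι : Type*} [Fintype ι] [DecidableEq ι]

/-- The positions in `F` are free of the short-or-flat restriction. They are released one at a time
by splitting the argument into its few large coordinates and a flat remainder. -/
theorem exists_norm_le_of_partly_short_or_flat
    (Φ : ContinuousMultilinearMap 𝕜 (fun _ : ι => LorentzPredual 𝕜 w) 𝕜)
    {A : Finset ι} (hA : A.Nonempty) (hw : ¬ Summable fun i => w i ^ A.card)
    (g : ι → LorentzPredual 𝕜 w) (F : Finset ι) :
    ∀ (S : Finset ι) (m : ℕ) {δ : ℝ}, 0 < δ →
    ∃ η > 0, ∃ n : ℕ, ∀ u : ι → LorentzPredual 𝕜 w, (∀ j ∉ A, u j = g j) →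
      (∀ j ∈ A, ‖u j‖ ≤ 1) → (∀ j ∈ A, ∀ i < n, u j i = 0) →
      (∀ j ∈ A, j ∉ F → j ∈ S → ∃ F : Finset ℕ, F.card ≤ m ∧ ∀ i ∉ F, u j i = 0) →
      (∀ j ∈ A, j ∉ F → j ∉ S → ∀ i, ‖u j i‖ ≤ η) → ‖Φ u‖ ≤ δ := by
  induction F using Finset.induction_on with
  | empty =>
    intro S m δ hδ
    simpa using exists_norm_le_of_short_or_flat Φ hA hw g S m hδ
  | insert a F ha ih =>
    intro S m δ hδ
    by_cases haA : a ∈ A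
    · obtain ⟨η₁, hη₁, n₁, h₁⟩ := ih (S.erase a) m (half_pos hδ)
      obtain ⟨m', hm'⟩ := exists_finset_card_le (𝕜 := 𝕜) w hη₁
      obtain ⟨η₂, hη₂, n₂, h₂⟩ := ih (insert a S) (max m m') (half_pos hδ)
      refine ⟨min η₁ η₂, lt_min hη₁ hη₂, max n₁ n₂, fun u hug hu1 hut huS huZ => ?_⟩
      obtain ⟨B, hBc, hB⟩ := hm' (u a) (hu1 a haA)
      have hoff : ∀ y, ∀ j ∉ A, Function.update u a y j = g j := fun y j hj => by
        rw [Function.update_of_ne (ne_of_mem_of_not_mem haA hj).symm, hug j hj]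
      have hball : ∀ s : Set ℕ, ∀ j ∈ A, ‖Function.update u a (proj s (u a)) j‖ ≤ 1 :=
        fun s j hj => by
          by_cases h : j = a
          · subst h; simpa using (norm_proj_le s (u j)).trans (hu1 j hj)
          · simpa [h] using hu1 j hj
      have htail : ∀ s : Set ℕ, ∀ j ∈ A, ∀ i < max n₁ n₂,
          Function.update u a (proj s (u a)) j i = 0 := fun s j hj i hi => by
        by_cases h : j = a
        · subst h; simp [proj_apply, hut j hj i hi]
        · simpa [h] using hut j hj i hi
      rw [show u = Function.update u a (proj B (u a) + proj (Bᶜ : Set ℕ) (u a)) by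
        rw [proj_add_proj_compl, Function.update_eq_self], Φ.map_update_add]
      refine (norm_add_le _ _).trans ((add_le_add (h₂ _ (hoff _) (hball _)
        (fun j hj i hi => htail _ j hj i (hi.trans_le (le_max_right _ _))) ?_ ?_)
        (h₁ _ (hoff _) (hball _)
        (fun j hj i hi => htail _ j hj i (hi.trans_le (le_max_left _ _))) ?_ ?_)).trans
        (add_halves δ).le)
      · intro j hj hjF hjS
        by_cases h : j = a
        · subst h
          refine ⟨B, hBc.trans (le_max_right _ _), fun i hi => ?_⟩
          rw [Function.update_self]
          exact proj_apply_of_notMem _ (by simpa using hi)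
        · obtain ⟨C, hC, hCz⟩ := huS j hj (by simp [h, hjF]) (by simpa [h] using hjS)
          exact ⟨C, hC.trans (le_max_left _ _), by simpa [h] using hCz⟩
      · intro j hj hjF hjS i
        have h : j ≠ a := fun h => hjS (by simp [h])
        rw [Function.update_of_ne h]
        exact (huZ j hj (by simp [h, hjF]) (fun h' => hjS (by simp [h'])) i).trans
          (min_le_right _ _)
      · intro j hj hjF hjS
        have h := Finset.ne_of_mem_erase hjS
        simpa [h] using huS j hj (by simp [h, hjF]) (Finset.mem_of_mem_erase hjS)
      · intro j hj hjF hjS i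
        by_cases h : j = a
        · subst h
          rw [Function.update_self]
          by_cases hi : i ∈ B
          · rw [proj_apply_of_notMem _ (by simpa using hi), norm_zero]
            exact hη₁.le
          · exact (norm_proj_apply_le _ _ _).trans (hB i hi)
        · rw [Function.update_of_ne h]
          exact (huZ j hj (by simp [h, hjF]) (fun h' => hjS (by simp [h, h'])) i).trans
            (min_le_left _ _)
    · obtain ⟨η, hη, n, h⟩ := ih S m hδ
      have hne : ∀ j ∈ A, j ∉ F → j ∉ insert a F := fun j hj hjF hja => by
        rcases Finset.mem_insert.mp hja with rfl | h
        · exact haA hj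
        · exact hjF h
      exact ⟨η, hη, n, fun u hug hu1 hut huS huZ => h u hug hu1 hut
        (fun j hj hjF => huS j hj (hne j hj hjF)) fun j hj hjF => huZ j hj (hne j hj hjF)⟩

/-- If `w ∉ ℓ_|A|`, a continuous multilinear form tends to `0` as its arguments in `A` move to
infinity in the unit ball while the others are fixed. -/
theorem exists_norm_le_of_tail
    (Φ : ContinuousMultilinearMap 𝕜 (fun _ : ι => LorentzPredual 𝕜 w) 𝕜)
    {A : Finset ι} (hA : A.Nonempty) (hw : ¬ Summable fun i => w i ^ A.card)
    (g : ι → LorentzPredual 𝕜 w) {δ : ℝ} (hδ : 0 < δ) :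
    ∃ n : ℕ, ∀ u : ι → LorentzPredual 𝕜 w, (∀ j ∉ A, u j = g j) →
      (∀ j ∈ A, ‖u j‖ ≤ 1) → (∀ j ∈ A, ∀ i < n, u j i = 0) → ‖Φ u‖ ≤ δ := by
  obtain ⟨η, -, n, h⟩ :=
    exists_norm_le_of_partly_short_or_flat Φ hA hw g Finset.univ ∅ 0 hδ
  exact ⟨n, fun u hug hu1 hut => h u hug hu1 hut (fun j _ hj => absurd (Finset.mem_univ j) hj)
    fun j _ hj => absurd (Finset.mem_univ j) hj⟩

/-- The arguments outside `A` may also range over the unit ball. -/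
theorem exists_norm_le_of_tail_of_ball
    (Φ : ContinuousMultilinearMap 𝕜 (fun _ : ι => LorentzPredual 𝕜 w) 𝕜)
    (hw : ¬ Summable fun i => w i ^ Fintype.card ι) (F : Finset ι) :
    ∀ {A : Finset ι}, A.Nonempty → ∀ (g : ι → LorentzPredual 𝕜 w) {δ : ℝ}, 0 < δ →
    ∃ n : ℕ, ∀ u : ι → LorentzPredual 𝕜 w, (∀ j ∉ A, j ∉ F → u j = g j) →
      (∀ j ∈ A, ‖u j‖ ≤ 1) → (∀ j ∈ F, ‖u j‖ ≤ 1) → (∀ j ∈ A, ∀ i < n, u j i = 0) →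
      ‖Φ u‖ ≤ δ := by
  induction F using Finset.induction_on with
  | empty =>
    intro A hA g δ hδ
    obtain ⟨n, h⟩ := exists_norm_le_of_tail Φ hA
      (fun h => hw (w.summable_pow_of_le (Finset.card_le_univ A) h)) g hδ
    exact ⟨n, fun u hug hu1 _ => h u (fun j hj => hug j hj (Finset.notMem_empty j)) hu1⟩
  | insert a F ha ih =>
    intro A hA g δ hδ
    by_cases haA : a ∈ A
    · obtain ⟨n, h⟩ := ih hA g hδ
      refine ⟨n, fun u hug hu1 huF => h u (fun j hj hjF => hug j hj ?_) hu1
        fun j hj => huF j (Finset.mem_insert_of_mem hj)⟩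
      simp only [Finset.mem_insert, not_or]
      exact ⟨fun h => hj (h ▸ haA), hjF⟩
    · obtain ⟨n₁, h₁⟩ := ih (A := insert a A) (Finset.insert_nonempty _ _) g (half_pos hδ)
      have hpos : 0 < δ / 2 / (n₁ + 1) := by positivity
      choose n₂ h₂ using fun i : ℕ => ih hA (Function.update g a (single i)) hpos
      refine ⟨max n₁ ((Finset.range n₁).sup n₂), fun u hug hu1 huF hut => ?_⟩
      have hua : ‖u a‖ ≤ 1 := huF a (Finset.mem_insert_self _ _)
      have hneA : ∀ j ∈ A, j ≠ a := fun j hj h => haA (h ▸ hj)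
      have hneF : ∀ j ∈ F, j ≠ a := fun j hj h => ha (h ▸ hj)
      have key₁ : ‖Φ (Function.update u a (proj (Set.Iio n₁)ᶜ (u a)))‖ ≤ δ / 2 := by
        refine h₁ _ (fun j hj hjF => ?_) (fun j hj => ?_) (fun j hj => ?_) fun j hj i hi => ?_
        · rw [Finset.mem_insert, not_or] at hj
          rw [Function.update_of_ne hj.1]
          exact hug j hj.2 (by simp [hj.1, hjF])
        · by_cases h : j = a
          · subst h
            rw [Function.update_self]
            exact (norm_proj_le _ _).trans hua
          · rw [Function.update_of_ne h]
            exact hu1 j (Finset.mem_of_mem_insert_of_ne hj h)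
        · rw [Function.update_of_ne (hneF j hj)]
          exact huF j (Finset.mem_insert_of_mem hj)
        · by_cases h : j = a
          · subst h
            rw [Function.update_self]
            exact proj_apply_of_notMem _ (by simpa using hi)
          · rw [Function.update_of_ne h]
            exact hut j (Finset.mem_of_mem_insert_of_ne hj h) i (hi.trans_le (le_max_left _ _))
      have key₂ : ∀ i ∈ Finset.range n₁,
          ‖u a i • Φ (Function.update u a (single i))‖ ≤ δ / 2 / (n₁ + 1) := by
        intro i hi
        rw [norm_smul]
        refine (mul_le_of_le_one_left (norm_nonneg _) ((norm_apply_le _ i).trans hua)).trans ?_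
        refine h₂ i _ (fun j hj hjF => ?_) (fun j hj => ?_) (fun j hj => ?_)
          fun j hj k hk => ?_
        · by_cases h : j = a
          · subst h; simp
          · rw [Function.update_of_ne h, Function.update_of_ne h]
            exact hug j hj (by simp [h, hjF])
        · rw [Function.update_of_ne (hneA j hj)]
          exact hu1 j hj
        · rw [Function.update_of_ne (hneF j hj)]
          exact huF j (Finset.mem_insert_of_mem hj)
        · rw [Function.update_of_ne (hneA j hj)]
          exact hut j hj k (hk.trans_le ((Finset.le_sup hi).trans (le_max_right _ _)))
      have key₃ : ‖Φ (Function.update u a (proj (Set.Iio n₁) (u a)))‖ ≤ δ / 2 := by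
        have h : Φ (Function.update u a (proj (Set.Iio n₁) (u a))) =
            ∑ i ∈ Finset.range n₁, u a i • Φ (Function.update u a (single i)) := by
          change Φ.toContinuousLinearMap u a _ = _
          rw [proj_Iio_eq_sum, map_sum]
          exact Finset.sum_congr rfl fun i _ => map_smul _ _ _
        rw [h]
        refine (norm_sum_le_of_le _ key₂).trans ?_
        have h0 : (0 : ℝ) < n₁ + 1 := by positivity
        rw [Finset.sum_const, Finset.card_range, nsmul_eq_mul, mul_div_assoc', div_le_iff₀ h0]
        nlinarith
      rw [show u = Function.update u a (proj (Set.Iio n₁) (u a) + proj (Set.Iio n₁)ᶜ (u a)) by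
        rw [proj_add_proj_compl, Function.update_eq_self], Φ.map_update_add]
      exact (norm_add_le _ _).trans ((add_le_add key₃ key₁).trans (add_halves δ).le)

/-- If `w ∉ ℓ_N`, continuous `N`-homogeneous polynomials are uniformly approximated on the unit
ball by their compositions with the coordinate projections. -/
theorem exists_norm_sub_proj_le
    (Φ : ContinuousMultilinearMap 𝕜 (fun _ : ι => LorentzPredual 𝕜 w) 𝕜)
    (hw : ¬ Summable fun i => w i ^ Fintype.card ι) {δ : ℝ} (hδ : 0 < δ) :
    ∃ n : ℕ, ∀ x : LorentzPredual 𝕜 w, ‖x‖ ≤ 1 →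
      ‖(Φ fun _ => x) - Φ fun _ => proj (Set.Iio n) x‖ ≤ δ := by
  have hδ' : 0 < δ / Fintype.card (Finset ι) :=
    div_pos hδ (by exact_mod_cast Fintype.card_pos)
  choose n hn using fun j : ι => exists_norm_le_of_tail_of_ball Φ hw Finset.univ
    (Finset.singleton_nonempty j) (fun _ => 0) hδ'
  refine ⟨Finset.univ.sup n, fun x hx => ?_⟩
  set P : ι → LorentzPredual 𝕜 w := fun _ => proj (Set.Iio (Finset.univ.sup n)) x
  set Q : ι → LorentzPredual 𝕜 w := fun _ => proj (Set.Iio (Finset.univ.sup n))ᶜ x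
  have hsum : (fun _ : ι => x) = P + Q := by
    ext1 j
    exact (proj_add_proj_compl _ x).symm
  -- The full subset gives the value at the projection; every other term of the expansion has at
  -- least one tail as argument.
  rw [hsum, Φ.map_add_univ, ← Finset.sum_erase_add _ _ (Finset.mem_univ Finset.univ),
    Finset.piecewise_univ, add_sub_cancel_right]
  have hle : ∀ s ∈ (Finset.univ : Finset (Finset ι)).erase Finset.univ,
      ‖Φ (s.piecewise P Q)‖ ≤ δ / Fintype.card (Finset ι) := by
    intro s hs
    obtain ⟨j, hj⟩ : ∃ j, j ∉ s := by
      by_contra! h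
      exact Finset.ne_of_mem_erase hs (Finset.eq_univ_iff_forall.mpr h)
    have hball : ∀ k, ‖s.piecewise P Q k‖ ≤ 1 := fun k => by
      by_cases hk : k ∈ s
      · rw [Finset.piecewise_eq_of_mem _ _ _ hk]; exact (norm_proj_le _ x).trans hx
      · rw [Finset.piecewise_eq_of_notMem _ _ _ hk]; exact (norm_proj_le _ x).trans hx
    refine hn j _ (fun k _ hk => absurd (Finset.mem_univ k) hk) (fun k _ => hball k)
      (fun k _ => hball k) fun k hk i hi => ?_
    rw [Finset.mem_singleton.mp hk, Finset.piecewise_eq_of_notMem _ _ _ hj]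
    refine proj_apply_of_notMem _ ?_
    simpa using hi.trans_le (Finset.le_sup (f := n) (Finset.mem_univ j))
  refine (norm_sum_le_of_le _ hle).trans ?_
  rw [Finset.sum_const, nsmul_eq_mul, Finset.card_erase_of_mem (Finset.mem_univ _)]
  have h0 : (0 : ℝ) < Fintype.card (Finset ι) := by exact_mod_cast Fintype.card_pos
  have h1 : (((Finset.univ : Finset (Finset ι)).card - 1 : ℕ) : ℝ) ≤ Fintype.card (Finset ι) := by
    exact_mod_cast Nat.sub_le _ _
  calc _ ≤ (Fintype.card (Finset ι) : ℝ) * (δ / Fintype.card (Finset ι)) :=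
        mul_le_mul_of_nonneg_right h1 hδ'.le
    _ = δ := mul_div_cancel₀ _ h0.ne'

/-- A continuous function of finitely many coordinates attains its supremum on the unit ball. -/
theorem isNormAttaining_comp_proj {p : LorentzPredual 𝕜 w → 𝕜} (hp : Continuous p) (n : ℕ) :
    IsNormAttaining fun x => p (proj (Set.Iio n) x) := by
  set f : (Fin n → 𝕜) → LorentzPredual 𝕜 w := fun a => ∑ i, a i • single (i : ℕ) with hf
  have hfc : Continuous f := by fun_prop
  have hfi : ∀ a (i : Fin n), f a i = a i := fun a i => by
    rw [hf, sum_apply]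
    simp [single_apply, Fin.val_inj]
  have hfp : ∀ x : LorentzPredual 𝕜 w, f (fun i => x i) = proj (Set.Iio n) x := fun x => by
    rw [hf, proj_Iio_eq_sum]
    exact Fin.sum_univ_eq_sum_range (fun i => x i • (single i : LorentzPredual 𝕜 w)) n
  have hproj : ∀ a, proj (Set.Iio n) (f a) = f a := fun a => by
    rw [← hfp]
    congr 1
    exact funext (hfi a)
  have hK : IsCompact {a | ‖f a‖ ≤ 1} := by
    refine Metric.isCompact_of_isClosed_isBounded (isClosed_le hfc.norm continuous_const) ?_
    refine (Metric.isBounded_closedBall (x := (0 : Fin n → 𝕜)) (r := 1)).subset fun a ha => ?_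
    rw [mem_closedBall_zero_iff, pi_norm_le_iff_of_nonneg zero_le_one]
    exact fun i => hfi a i ▸ (norm_apply_le _ _).trans ha
  obtain ⟨a, ha, hmax⟩ := hK.exists_isMaxOn ⟨0, by simp [hf]⟩ (hp.comp hfc).norm.continuousOn
  have hle : ∀ x : Metric.closedBall (0 : LorentzPredual 𝕜 w) 1,
      ‖p (proj (Set.Iio n) x)‖ ≤ ‖p (f a)‖ := fun x => by
    rw [← hfp]
    refine hmax (a := fun i => (x : LorentzPredual 𝕜 w) i) ?_
    change ‖f _‖ ≤ 1
    rw [hfp]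
    exact (norm_proj_le _ _).trans (mem_closedBall_zero_iff.mp x.2)
  have : Nonempty (Metric.closedBall (0 : LorentzPredual 𝕜 w) 1) := ⟨⟨0, by simp⟩⟩
  refine ⟨f a, ha, le_antisymm ?_ ?_⟩
  · exact le_ciSup (f := fun x : Metric.closedBall (0 : LorentzPredual 𝕜 w) 1 =>
      ‖p (proj (Set.Iio n) x)‖) ⟨_, by rintro _ ⟨x, rfl⟩; exact hle x⟩
      ⟨f a, mem_closedBall_zero_iff.mpr ha⟩
  · simp only [hproj]
    exact ciSup_le hle

theorem approximatedBy_normAttaining_of_not_summable {N : ℕ}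
    (hw : ¬ Summable fun i => w i ^ N) :
    ApproximatedBy (homogeneousPolynomials 𝕜 (LorentzPredual 𝕜 w) N)
      (normAttainingHomogeneousPolynomials 𝕜 (LorentzPredual 𝕜 w) N) := by
  rintro q ⟨Φ, hΦ⟩ ε hε
  obtain ⟨n, hn⟩ := exists_norm_sub_proj_le Φ (by simpa using hw) (half_pos hε)
  refine ⟨fun x => q (proj (Set.Iio n) x),
    ⟨⟨Φ.compContinuousLinearMap fun _ => proj (Set.Iio n), fun x => hΦ _⟩,
      isNormAttaining_comp_proj ?_ n⟩, ?_⟩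
  · rw [funext hΦ]
    exact Φ.cont.comp (continuous_pi fun _ => continuous_id)
  · have : Nonempty (Metric.closedBall (0 : LorentzPredual 𝕜 w) 1) := ⟨⟨0, by simp⟩⟩
    refine lt_of_le_of_lt (ciSup_le fun x => ?_) (half_lt_self hε)
    rw [Pi.sub_apply, hΦ, hΦ]
    exact hn x (mem_closedBall_zero_iff.mp x.2)

end LorentzPredual

/-! ### Coefficients and directional expansions of polynomials of bounded degree. -/

theorem homogeneousPolynomials_subset_polynomialsOfDegreeLE {𝕜 X : Type*} [RCLike 𝕜]
    [NormedAddCommGroup X] [NormedSpace 𝕜 X] {N k : ℕ} (h : N ≤ k) :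
    homogeneousPolynomials 𝕜 X N ⊆ polynomialsOfDegreeLE 𝕜 X k := by
  intro p hp
  refine ⟨fun j => if j = N then p else 0, fun j => ?_, fun x => ?_⟩
  · by_cases hj : j = N
    · subst hj; simpa using hp
    · simpa [hj] using ⟨0, fun x => by simp⟩
  · rw [Finset.sum_eq_single N (fun j _ hj => by simp [hj]) (fun hN => absurd hN (by simp; omega))]
    simp

/-- The coefficients of a polynomial of bounded degree are controlled by its values on `[0,1]`. -/
theorem exists_norm_coeff_le (𝕜 : Type*) [RCLike 𝕜] (N : ℕ) :
    ∃ C > 0, ∀ (a : ℕ → 𝕜) (ε : ℝ), (∀ t : ℝ, 0 ≤ t → t ≤ 1 →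
      ‖∑ j ∈ Finset.range (N + 1), a j * (t : 𝕜) ^ j‖ ≤ ε) → ∀ j ≤ N, ‖a j‖ ≤ C * ε := by
  -- Distinct nodes in `[0,1]`: the inverse Vandermonde matrix recovers the coefficients from the
  -- values there.
  set v : Fin (N + 1) → 𝕜 := fun i => (((i : ℕ) / (N + 1) : ℝ) : 𝕜) with hv
  have hN : (0 : ℝ) < N + 1 := by positivity
  have hinj : Function.Injective v := fun i j hij => by
    have h1 : ((i : ℕ) : ℝ) / (N + 1) = (j : ℕ) / (N + 1) := RCLike.ofReal_injective hij
    rw [div_left_inj' hN.ne'] at h1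
    exact Fin.ext (by exact_mod_cast h1)
  set V := Matrix.vandermonde v with hV
  have hdet : IsUnit V.det := (Matrix.det_vandermonde_ne_zero_iff.mpr hinj).isUnit
  have hnn : 0 ≤ ∑ i, ∑ j, ‖V⁻¹ i j‖ :=
    Finset.sum_nonneg fun i _ => Finset.sum_nonneg fun j _ => norm_nonneg _
  refine ⟨∑ i, ∑ j, ‖V⁻¹ i j‖ + 1, by linarith, fun a ε h j hj => ?_⟩
  have hε : 0 ≤ ε := (norm_nonneg _).trans (h 0 le_rfl zero_le_one)
  set b : Fin (N + 1) → 𝕜 := fun i => a i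
  have hVb : ∀ i, ‖(V.mulVec b) i‖ ≤ ε := fun i => by
    have h1 : (V.mulVec b) i = ∑ j ∈ Finset.range (N + 1), a j * v i ^ j := by
      rw [Finset.sum_range]
      simp only [Matrix.mulVec, dotProduct, hV, Matrix.vandermonde_apply]
      exact Finset.sum_congr rfl fun k _ => mul_comm _ _
    rw [h1]
    refine h _ (by positivity) ?_
    rw [div_le_one hN]
    exact_mod_cast i.2.le
  have hb : b = V⁻¹.mulVec (V.mulVec b) := by
    rw [Matrix.mulVec_mulVec, Matrix.nonsing_inv_mul V hdet, Matrix.one_mulVec]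
  set i : Fin (N + 1) := ⟨j, by omega⟩
  have h2 : ‖a j‖ ≤ ∑ k, ‖V⁻¹ i k‖ * ε := by
    have h3 : a j = ∑ k, V⁻¹ i k * (V.mulVec b) k := congrFun hb i
    rw [h3]
    refine norm_sum_le_of_le _ fun k _ => ?_
    rw [norm_mul]
    exact mul_le_mul_of_nonneg_left (hVb k) (norm_nonneg _)
  rw [← Finset.sum_mul] at h2
  refine h2.trans (mul_le_mul_of_nonneg_right ?_ hε)
  have h3 := Finset.single_le_sum (f := fun i => ∑ j, ‖V⁻¹ i j‖)
    (fun i _ => Finset.sum_nonneg fun j _ => norm_nonneg _) (Finset.mem_univ i)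
  linarith

section Polynomials

variable {𝕜 X : Type*} [RCLike 𝕜] [NormedAddCommGroup X] [NormedSpace 𝕜 X]

theorem homogeneousPolynomials_smul {N : ℕ} {p : X → 𝕜} (hp : p ∈ homogeneousPolynomials 𝕜 X N)
    (c : 𝕜) (x : X) : p (c • x) = c ^ N * p x := by
  obtain ⟨Φ, hΦ⟩ := hp
  rw [hΦ, hΦ]
  simpa using Φ.map_smul_univ (fun _ => c) fun _ => x

theorem sub_mem_polynomialsOfDegreeLE {k : ℕ} {p q : X → 𝕜}
    (hp : p ∈ polynomialsOfDegreeLE 𝕜 X k) (hq : q ∈ polynomialsOfDegreeLE 𝕜 X k) :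
    p - q ∈ polynomialsOfDegreeLE 𝕜 X k := by
  obtain ⟨P, hP, hpP⟩ := hp
  obtain ⟨Q, hQ, hqQ⟩ := hq
  refine ⟨P - Q, fun j => ?_, fun x => ?_⟩
  · obtain ⟨Φ, hΦ⟩ := hP j
    obtain ⟨Ψ, hΨ⟩ := hQ j
    exact ⟨Φ - Ψ, fun x => by simp [hΦ, hΨ]⟩
  · simp [hpP, hqQ]

theorem norm_le_ballSupNorm {k : ℕ} {p : X → 𝕜} (hp : p ∈ polynomialsOfDegreeLE 𝕜 X k) {x : X}
    (hx : ‖x‖ ≤ 1) : ‖p x‖ ≤ ballSupNorm p :=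
  le_ciSup (bddAbove_of_mem_polynomialsOfDegreeLE hp) ⟨x, mem_closedBall_zero_iff.mpr hx⟩

/-- Polynomials of bounded degree that are small on the unit ball are small on the ball of
radius `2`. -/
theorem exists_norm_le_on_ball_two (𝕜 X : Type*) [RCLike 𝕜] [NormedAddCommGroup X]
    [NormedSpace 𝕜 X] (N : ℕ) :
    ∃ C > 0, ∀ p ∈ polynomialsOfDegreeLE 𝕜 X N, ∀ ε : ℝ, (∀ x, ‖x‖ ≤ 1 → ‖p x‖ ≤ ε) →
      ∀ x, ‖x‖ ≤ 2 → ‖p x‖ ≤ C * ε := by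
  obtain ⟨C, hC, h⟩ := exists_norm_coeff_le 𝕜 N
  refine ⟨(N + 1) * (C * 2 ^ N), by positivity, fun p ⟨q, hq, hpq⟩ ε hε x hx => ?_⟩
  have hε0 : 0 ≤ ε := (norm_nonneg _).trans (hε 0 (by simp))
  set y : X := (2 : 𝕜)⁻¹ • x with hy
  have hxy : x = (2 : 𝕜) • y := by rw [hy, smul_smul, mul_inv_cancel₀ two_ne_zero, one_smul]
  have hp : ∀ c : 𝕜, p (c • y) = ∑ j ∈ Finset.range (N + 1), q j y * c ^ j := fun c => by
    rw [hpq]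
    exact Finset.sum_congr rfl fun j _ => by rw [homogeneousPolynomials_smul (hq j), mul_comm]
  have hyn : ‖y‖ ≤ 1 := by
    rw [hy, norm_smul, norm_inv, RCLike.norm_ofNat]
    linarith
  -- Along the ray through `y = x / 2` the coefficients of `p` are the `q j y`. They are controlled
  -- by `t ∈ [0,1]` and then evaluated at `2`.
  have hcoeff := h (fun j => q j y) ε fun t ht0 ht1 => by
    rw [← hp]
    refine hε _ ?_
    rw [norm_smul, RCLike.norm_ofReal, abs_of_nonneg ht0]
    exact mul_le_one₀ ht1 (norm_nonneg _) hyn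
  rw [hxy, hp]
  have hle : ∀ j ∈ Finset.range (N + 1), ‖q j y * 2 ^ j‖ ≤ C * ε * 2 ^ N := fun j hj => by
    have hj' : j ≤ N := Nat.lt_succ_iff.mp (Finset.mem_range.mp hj)
    rw [norm_mul, norm_pow, RCLike.norm_ofNat]
    exact mul_le_mul (hcoeff j hj') (pow_le_pow_right₀ one_le_two hj') (by positivity)
      (by positivity)
  refine (norm_sum_le_of_le _ hle).trans (le_of_eq ?_)
  rw [Finset.sum_const, Finset.card_range, nsmul_eq_mul]
  push_cast
  ring

/-- The coefficient of `c ^ j` in the expansion of `∑_{l ≤ N} Φ_l (x + c • e, …, x + c • e)`. -/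
noncomputable def directionalCoeff (Φ : ∀ l : ℕ, ContinuousMultilinearMap 𝕜 (fun _ : Fin l => X) 𝕜)
    (N : ℕ) (x e : X) (j : ℕ) : 𝕜 :=
  ∑ l ∈ Finset.range (N + 1), ∑ J : Finset (Fin l) with J.card = j,
    Φ l (J.piecewise (fun _ => e) fun _ => x)

variable (Φ : ∀ l : ℕ, ContinuousMultilinearMap 𝕜 (fun _ : Fin l => X) 𝕜) (N : ℕ)

theorem sum_directionalCoeff (x e : X) (c : 𝕜) :
    ∑ l ∈ Finset.range (N + 1), Φ l (fun _ => x + c • e) =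
      ∑ j ∈ Finset.range (N + 1), directionalCoeff Φ N x e j * c ^ j := by
  simp only [directionalCoeff, Finset.sum_mul]
  rw [Finset.sum_comm]
  refine Finset.sum_congr rfl fun l hl => ?_
  have hl' : l ≤ N := Nat.lt_succ_iff.mp (Finset.mem_range.mp hl)
  have h1 : (fun _ : Fin l => x + c • e) = (fun _ => c • e) + fun _ => x := by
    ext1 i; exact add_comm _ _
  rw [h1, (Φ l).map_add_univ, ← Finset.sum_fiberwise_of_maps_to
    (t := Finset.range (N + 1)) (g := Finset.card) fun J _ => Finset.mem_range.mpr
      (Nat.lt_succ_iff.mpr ((Finset.card_le_univ J).trans (by simpa using hl')))]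
  refine Finset.sum_congr rfl fun j _ => Finset.sum_congr rfl fun J hJ => ?_
  have h2 : J.piecewise (fun _ => c • e) (fun _ => x) =
      J.piecewise (fun i => c • J.piecewise (fun _ => e) (fun _ => x) i)
        (J.piecewise (fun _ => e) fun _ => x) := by
    ext1 i
    by_cases hi : i ∈ J <;> simp [hi]
  rw [h2]
  have h3 := (Φ l).toMultilinearMap.map_piecewise_smul (fun _ => c)
    (J.piecewise (fun _ => e) fun _ => x) J
  rw [Finset.prod_const, (Finset.mem_filter.mp hJ).2, smul_eq_mul, mul_comm] at h3
  exact h3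

theorem directionalCoeff_zero (x e : X) :
    directionalCoeff Φ N x e 0 = ∑ l ∈ Finset.range (N + 1), Φ l fun _ => x := by
  have h := sum_directionalCoeff Φ N x e 0
  have h0 : ∑ j ∈ Finset.range (N + 1), directionalCoeff Φ N x e j * (0 : 𝕜) ^ j =
      directionalCoeff Φ N x e 0 := by
    rw [Finset.sum_eq_single 0 (fun j _ hj => by simp [hj]) (fun h => absurd h (by simp))]
    simp
  rw [← h0, ← h, zero_smul, add_zero]

/-- Summing `‖Φ l‖` over all subsets, whatever their size, gives one bound for every order `j`. -/
theorem exists_norm_directionalCoeff_le :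
    ∃ B, 0 ≤ B ∧ ∀ x e : X, ‖x‖ ≤ 1 → ‖e‖ ≤ 1 → ∀ j, ‖directionalCoeff Φ N x e j‖ ≤ B := by
  refine ⟨∑ l ∈ Finset.range (N + 1), ∑ _J : Finset (Fin l), ‖Φ l‖,
    Finset.sum_nonneg fun l _ => Finset.sum_nonneg fun J _ => norm_nonneg _,
    fun x e hx he j => norm_sum_le_of_le _ fun l _ => ?_⟩
  refine (norm_sum_le _ _).trans ((Finset.sum_le_sum fun J _ => ?_).trans
    (Finset.sum_le_sum_of_subset_of_nonneg (Finset.filter_subset _ _)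
      fun _ _ _ => norm_nonneg (Φ l)))
  refine ((Φ l).le_opNorm _).trans (mul_le_of_le_one_right (norm_nonneg _)
    (Finset.prod_le_one (fun _ _ => norm_nonneg _) fun i _ => ?_))
  by_cases hi : i ∈ J <;> simp [hi, hx, he]

end Polynomials

/-! ### Vanishing directional coefficients and the polynomial `powerSum`. -/

theorem Finset.prod_le_sum_pow_card {ι : Type*} {s : Finset ι} (hs : s.Nonempty) {a : ι → ℝ}
    (ha : ∀ j ∈ s, 0 ≤ a j) : ∏ j ∈ s, a j ≤ ∑ j ∈ s, a j ^ s.card := by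
  obtain ⟨k, hk, hmax⟩ := s.exists_max_image a hs
  calc ∏ j ∈ s, a j ≤ ∏ _j ∈ s, a k := Finset.prod_le_prod ha hmax
    _ = a k ^ s.card := Finset.prod_const _
    _ ≤ _ := Finset.single_le_sum (f := fun j => a j ^ s.card)
      (fun j hj => pow_nonneg (ha j hj) _) hk

namespace LorentzPredual

variable {𝕜 : Type*} [RCLike 𝕜] {w : AdmissibleSeq}

/-- In each term the unit vector fills the `j` positions of `J` and `x` the others, so
`exists_norm_le_of_tail` applies with `A = J`. Only `w ∉ ℓ_j` matters, not the degree `l`. -/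
theorem tendsto_directionalCoeff
    (Φ : ∀ l : ℕ, ContinuousMultilinearMap 𝕜 (fun _ : Fin l => LorentzPredual 𝕜 w) 𝕜) (N : ℕ)
    (x : LorentzPredual 𝕜 w) {j : ℕ} (hj : j ≠ 0) (hw : ¬ Summable fun i => w i ^ j) :
    Tendsto (fun n => directionalCoeff Φ N x (single n) j) atTop (𝓝 0) := by
  rw [show (0 : 𝕜) = ∑ l ∈ Finset.range (N + 1), ∑ J : Finset (Fin l) with J.card = j, 0 by simp]
  refine tendsto_finsetSum _ fun l _ => tendsto_finsetSum _ fun J hJ => ?_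
  have hJ := (Finset.mem_filter.mp hJ).2
  refine NormedAddGroup.tendsto_nhds_zero.mpr fun ε hε => ?_
  obtain ⟨n, hn⟩ := exists_norm_le_of_tail (Φ l)
    (Finset.card_pos.mp (by omega : 0 < J.card)) (hJ ▸ hw) (fun _ => x) (half_pos hε)
  refine eventually_atTop.mpr ⟨n, fun k hk => lt_of_le_of_lt (hn _ (fun i hi => by simp [hi])
    (fun i hi => by simpa [hi] using norm_single_le k) fun i hi r hr => ?_) (half_lt_self hε)⟩
  rw [Finset.piecewise_eq_of_mem _ _ _ hi, single_apply, if_neg (by omega)]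

theorem summable_norm_pow {M : ℕ} (hs : Summable fun i => w i ^ M) (x : LorentzPredual 𝕜 w) :
    Summable fun i => ‖x i‖ ^ M := by
  have h0 : (0 : ℝ) < ‖x‖ + 1 := by positivity
  have hy : ‖((‖x‖ + 1 : ℝ) : 𝕜)⁻¹ • x‖ ≤ 1 := by
    rw [norm_smul, norm_inv, RCLike.norm_ofReal, abs_of_pos h0, inv_mul_le_iff₀ h0]
    linarith
  have h1 : Summable fun i => ‖(((‖x‖ + 1 : ℝ) : 𝕜)⁻¹ • x) i‖ ^ M :=
    summable_of_sum_le (fun i => pow_nonneg (norm_nonneg _) _) fun A =>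
      (sum_norm_pow_le _ hy M A).trans
        (hs.sum_le_tsum _ fun i _ => pow_nonneg (w.nonneg' i) _)
  refine (h1.mul_left ((‖x‖ + 1) ^ M)).congr fun i => ?_
  rw [smul_apply, norm_mul, norm_inv, RCLike.norm_ofReal, abs_of_pos h0, ← mul_pow,
    mul_inv_cancel_left₀ h0.ne']

theorem tsum_norm_pow_le {M : ℕ} (hs : Summable fun i => w i ^ M) {x : LorentzPredual 𝕜 w}
    (hx : ‖x‖ ≤ 1) : ∑' i, ‖x i‖ ^ M ≤ ∑' i, w i ^ M :=
  Real.tsum_le_of_sum_le (fun _ => pow_nonneg (norm_nonneg _) _) fun A =>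
    (sum_norm_pow_le _ hx M A).trans (hs.sum_le_tsum _ fun i _ => pow_nonneg (w.nonneg' i) _)

theorem summable_pow {M : ℕ} (hs : Summable fun i => w i ^ M) (x : LorentzPredual 𝕜 w) :
    Summable fun i => x i ^ M :=
  Summable.of_norm (by simpa using summable_norm_pow hs x)

/-- If `w ∈ ℓ_M` with `M = |s|`, then `m ↦ ∑ i, ∏_{j ∈ s} m j i * ∏_{j ∉ s} m j 0` is a continuous
multilinear form. -/
theorem exists_multilinear {ι : Type*} [Fintype ι] [DecidableEq ι] {s : Finset ι}
    (hne : s.Nonempty) (hs : Summable fun i => w i ^ s.card) :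
    ∃ Φ : ContinuousMultilinearMap 𝕜 (fun _ : ι => LorentzPredual 𝕜 w) 𝕜,
      ∀ x : LorentzPredual 𝕜 w, (Φ fun _ => x) =
        x 0 ^ (Fintype.card ι - s.card) * ∑' i, x i ^ s.card := by
  set F : ℕ → MultilinearMap 𝕜 (fun _ : ι => LorentzPredual 𝕜 w) 𝕜 := fun i =>
    (MultilinearMap.mkPiAlgebra 𝕜 ι 𝕜).compLinearMap
      fun j => if j ∈ s then coord i else coord 0 with hF
  have hFapp : ∀ i m, F i m = (∏ j ∈ s, m j i) * ∏ j ∈ sᶜ, m j 0 := fun i m => by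
    rw [hF, MultilinearMap.compLinearMap_apply, MultilinearMap.mkPiAlgebra_apply,
      ← Finset.prod_mul_prod_compl s]
    congr 1
    · exact Finset.prod_congr rfl fun j hj => by rw [if_pos hj]; rfl
    · exact Finset.prod_congr rfl fun j hj => by rw [if_neg (Finset.mem_compl.mp hj)]; rfl
  have hle : ∀ i m, ‖F i m‖ ≤ (∑ j ∈ s, ‖m j i‖ ^ s.card) * ∏ j ∈ sᶜ, ‖m j‖ := fun i m => by
    rw [hFapp, norm_mul, norm_prod, norm_prod]
    exact mul_le_mul (Finset.prod_le_sum_pow_card hne fun j _ => norm_nonneg _)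
      (Finset.prod_le_prod (fun j _ => norm_nonneg _) fun j _ => norm_apply_le _ _)
      (Finset.prod_nonneg fun j _ => norm_nonneg _)
      (Finset.sum_nonneg fun j _ => pow_nonneg (norm_nonneg _) _)
  have hsum' : ∀ m : ι → LorentzPredual 𝕜 w, Summable fun i =>
      (∑ j ∈ s, ‖m j i‖ ^ s.card) * ∏ j ∈ sᶜ, ‖m j‖ := fun m =>
    (summable_sum fun j _ => summable_norm_pow hs (m j)).mul_right _
  have hsum : ∀ m, Summable fun i => F i m := fun m =>
    Summable.of_norm_bounded (hsum' m) fun i => hle i m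
  set Ψ : MultilinearMap 𝕜 (fun _ : ι => LorentzPredual 𝕜 w) 𝕜 :=
    { toFun := fun m => ∑' i, F i m
      map_update_add' := fun m j x y => by
        rename_i inst
        rw [Subsingleton.elim inst ‹DecidableEq ι›, ← (hsum _).tsum_add (hsum _)]
        exact tsum_congr fun i => (F i).map_update_add m j x y
      map_update_smul' := fun m j c x => by
        rename_i inst
        rw [Subsingleton.elim inst ‹DecidableEq ι›, smul_eq_mul, ← tsum_mul_left]
        exact tsum_congr fun i => (F i).map_update_smul m j c x } with hΨ
  have hball : ∀ m : ι → LorentzPredual 𝕜 w, (∀ j, ‖m j‖ ≤ 1) →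
      ‖Ψ m‖ ≤ s.card * ∑' i, w i ^ s.card := fun m hm => by
    have h1 : ∏ j ∈ sᶜ, ‖m j‖ ≤ 1 :=
      Finset.prod_le_one (fun j _ => norm_nonneg _) fun j _ => hm j
    have h2 : HasSum (fun i => ∑ j ∈ s, ‖m j i‖ ^ s.card) (∑ j ∈ s, ∑' i, ‖m j i‖ ^ s.card) :=
      hasSum_sum fun j _ => (summable_norm_pow hs (m j)).hasSum
    refine (tsum_of_norm_bounded h2 fun i => (hle i m).trans ?_).trans ?_
    · exact mul_le_of_le_one_right
        (Finset.sum_nonneg fun j _ => pow_nonneg (norm_nonneg _) _) h1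
    · refine (Finset.sum_le_card_nsmul _ _ _ fun j _ => tsum_norm_pow_le hs (hm j)).trans_eq ?_
      rw [nsmul_eq_mul]
  refine ⟨Ψ.mkContinuous (s.card * ∑' i, w i ^ s.card) fun m => ?_, fun x => ?_⟩
  -- Homogeneity extends the bound from the unit ball; a zero argument is harmless because its
  -- factor `‖m j‖` vanishes.
  · have hm : m = fun j => (‖m j‖ : 𝕜) • ((‖m j‖ : 𝕜)⁻¹ • m j) := by
      ext1 j
      by_cases h : m j = 0
      · simp [h]
      · rw [smul_smul, mul_inv_cancel₀ (by simpa using h), one_smul]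
    have hmn : ∀ j, ‖(‖m j‖ : 𝕜)⁻¹ • m j‖ ≤ 1 := fun j => by
      rw [norm_smul, norm_inv, RCLike.norm_ofReal, abs_norm]
      exact inv_mul_le_one
    conv_lhs => rw [hm]
    rw [Ψ.map_smul_univ, norm_smul, norm_prod, mul_comm]
    simp only [RCLike.norm_ofReal, abs_norm]
    exact mul_le_mul_of_nonneg_right (hball _ hmn) (Finset.prod_nonneg fun j _ => norm_nonneg _)
  · change ∑' i, F i (fun _ => x) = _
    rw [← tsum_mul_left]
    refine tsum_congr fun i => ?_
    rw [hFapp, Finset.prod_const, Finset.prod_const, Finset.card_compl, mul_comm]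

/-- The polynomial `x ↦ x(0)^(N-M) ∑ i, x(i)^M`. -/
noncomputable def powerSum (M N : ℕ) (x : LorentzPredual 𝕜 w) : 𝕜 :=
  x 0 ^ (N - M) * ∑' i, x i ^ M

theorem powerSum_mem {M N : ℕ} (hM : M ≠ 0) (hMN : M ≤ N) (hs : Summable fun i => w i ^ M) :
    powerSum M N ∈ homogeneousPolynomials 𝕜 (LorentzPredual 𝕜 w) N := by
  obtain ⟨s, -, hcard⟩ := Finset.exists_subset_card_eq
    (s := (Finset.univ : Finset (Fin N))) (n := M) (by simpa using hMN)
  obtain ⟨Φ, hΦ⟩ := exists_multilinear (𝕜 := 𝕜) (w := w)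
    (Finset.card_pos.mp (by omega : 0 < s.card)) (by rwa [hcard])
  exact ⟨Φ, fun x => by rw [hΦ, hcard, Fintype.card_fin, powerSum]⟩

/-- Together with `norm_single_le` this bounds the norm of `powerSum` below by `1`. -/
theorem powerSum_single_zero {M N : ℕ} (hM : M ≠ 0) :
    powerSum M N (single 0 : LorentzPredual 𝕜 w) = 1 := by
  rw [powerSum, tsum_eq_single 0 fun i hi => by simp [single_apply, hi, hM]]
  simp [single_apply]

theorem norm_powerSum_le {M N : ℕ} (hs : Summable fun i => w i ^ M) {x : LorentzPredual 𝕜 w}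
    (hx : ‖x‖ ≤ 1) : ‖powerSum M N x‖ ≤ ∑' i, w i ^ M := by
  rw [powerSum, norm_mul, norm_pow]
  refine (mul_le_of_le_one_left (norm_nonneg _)
    (pow_le_one₀ (norm_nonneg _) ((norm_apply_le x 0).trans hx))).trans ?_
  have h := summable_norm_pow hs x
  simp only [← norm_pow] at h
  refine (norm_tsum_le_tsum_norm h).trans ?_
  simpa only [norm_pow] using tsum_norm_pow_le hs hx

/-- Expansion of `powerSum` in the direction of a unit vector. -/
theorem powerSum_add_smul_single {M N : ℕ} (hM : M ≠ 0) (hMN : M ≤ N)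
    (hs : Summable fun i => w i ^ M) (x : LorentzPredual 𝕜 w) {n : ℕ} (hn : n ≠ 0) :
    ∃ b : ℕ → 𝕜, b M = x 0 ^ (N - M) ∧ ∀ c : 𝕜,
      powerSum M N (x + c • single n) = ∑ j ∈ Finset.range (N + 1), b j * c ^ j := by
  set T : 𝕜 := ∑' i, x i ^ M with hT
  -- Only the `n`-th summand changes, to `(x n + c) ^ M`, and `n ≠ 0` keeps the factor at coordinate
  -- `0`. The other summands enter the constant coefficient.
  refine ⟨fun j => x 0 ^ (N - M) * (x n ^ (M - j) * (M.choose j : 𝕜) +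
    if j = 0 then T - x n ^ M else 0), by simp [hM], fun c => ?_⟩
  have h0 : (x + c • (single n : LorentzPredual 𝕜 w)) 0 = x 0 := by
    simp [single_apply, hn.symm]
  have hsum : HasSum (fun i => (x + c • (single n : LorentzPredual 𝕜 w)) i ^ M)
      (T + ((x n + c) ^ M - x n ^ M)) := by
    have h1 := (summable_pow hs x).hasSum.add
      (hasSum_ite_eq n ((x n + c) ^ M - x n ^ M))
    refine h1.congr_fun fun i => ?_
    by_cases hi : i = n
    · subst hi; simp [single_apply]
    · simp [single_apply, hi]
  rw [powerSum, h0, hsum.tsum_eq]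
  have hbin : (x n + c) ^ M =
      ∑ j ∈ Finset.range (N + 1), x n ^ (M - j) * (M.choose j : 𝕜) * c ^ j := by
    rw [add_comm, add_pow]
    refine (Finset.sum_subset (Finset.range_subset_range.mpr (by omega))
      fun j _ hj => ?_).trans (Finset.sum_congr rfl fun j _ => by ring)
    rw [Finset.mem_range, not_lt] at hj
    rw [Nat.choose_eq_zero_of_lt (by omega), Nat.cast_zero, mul_zero]
  simp only [mul_assoc, ← Finset.mul_sum]
  congr 1
  simp only [add_mul, Finset.sum_add_distrib]
  rw [← hbin, Finset.sum_eq_single 0 (fun j _ hj => by simp [hj])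
    (fun h => absurd h (by simp))]
  simp
  ring

/-- A direction in which the polynomial `powerSum` grows at a given point. -/
theorem exists_direction {M N : ℕ} (hM : M ≠ 0) (hs : Summable fun i => w i ^ M)
    {x : LorentzPredual 𝕜 w} (hx : ‖x‖ ≤ 1) (hQ : powerSum M N x ≠ 0) :
    ∃ θ : 𝕜, ‖θ‖ = 1 ∧ ‖powerSum M N x‖ ^ 2 / (2 * ∑' i, w i ^ M) ≤
      RCLike.re (starRingEnd 𝕜 (powerSum M N x) * (x 0 ^ (N - M) * θ ^ M)) := by
  set S := ∑' i, w i ^ M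
  set Q := powerSum M N x with hQdef
  have hQ0 : 0 < ‖Q‖ := norm_pos_iff.mpr hQ
  have hS : ‖Q‖ ≤ S := norm_powerSum_le hs hx
  have hS0 : 0 < S := hQ0.trans_le hS
  -- An average over the directions `x i / ‖x i‖` with weights `‖x i‖ ^ M`: the weighted terms add
  -- up to `‖Q‖ ^ 2` while the weights sum to at most `S`. The factor `2` makes the contradiction
  -- strict.
  by_contra! hcon
  have hterm : ∀ i, RCLike.re (starRingEnd 𝕜 Q * (x 0 ^ (N - M) * x i ^ M)) ≤
      ‖Q‖ ^ 2 / (2 * S) * ‖x i‖ ^ M := by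
    intro i
    by_cases hi : x i = 0
    · simp [hi, hM]
    · have hi' : 0 < ‖x i‖ := norm_pos_iff.mpr hi
      have h1 := hcon ((‖x i‖ : 𝕜)⁻¹ * x i) (by
        rw [norm_mul, norm_inv, RCLike.norm_ofReal, abs_norm, inv_mul_cancel₀ hi'.ne'])
      have h2 : starRingEnd 𝕜 Q * (x 0 ^ (N - M) * x i ^ M) = ((‖x i‖ ^ M : ℝ) : 𝕜) *
          (starRingEnd 𝕜 Q * (x 0 ^ (N - M) * ((‖x i‖ : 𝕜)⁻¹ * x i) ^ M)) := by
        have h3 : (‖x i‖ : 𝕜) ^ M ≠ 0 := pow_ne_zero _ (by exact_mod_cast hi'.ne')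
        push_cast
        rw [mul_pow, inv_pow]
        field_simp
      rw [h2, RCLike.re_ofReal_mul, mul_comm]
      exact mul_le_mul_of_nonneg_right h1.le (pow_nonneg (norm_nonneg _) _)
  have hl : HasSum (fun i => RCLike.re (starRingEnd 𝕜 Q * (x 0 ^ (N - M) * x i ^ M)))
      (‖Q‖ ^ 2) := by
    have h1 := (((summable_pow hs x).hasSum.mul_left (x 0 ^ (N - M))).mul_left
      (starRingEnd 𝕜 Q)).mapL (RCLike.reCLM (K := 𝕜))
    have h2 : RCLike.re (starRingEnd 𝕜 Q * (x 0 ^ (N - M) * ∑' i, x i ^ M)) = ‖Q‖ ^ 2 := by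
      change RCLike.re (starRingEnd 𝕜 Q * Q) = _
      rw [RCLike.conj_mul, ← RCLike.ofReal_pow, RCLike.ofReal_re]
    rw [← h2]
    exact h1
  have hr := (summable_norm_pow hs x).hasSum.mul_left (‖Q‖ ^ 2 / (2 * S))
  have h1 := hasSum_le hterm hl hr
  have h2 := mul_le_mul_of_nonneg_left (tsum_norm_pow_le hs hx)
    (by positivity : 0 ≤ ‖Q‖ ^ 2 / (2 * S))
  have h3 : ‖Q‖ ^ 2 / (2 * S) * S = ‖Q‖ ^ 2 / 2 := by field_simp
  change _ ≤ ‖Q‖ ^ 2 / (2 * S) * S at h2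
  nlinarith [pow_pos hQ0 2]

end LorentzPredual

/-! ### Failure of approximation when `w ∈ ℓ_M`. -/

namespace LorentzPredual

variable {𝕜 : Type*} [RCLike 𝕜] {w : AdmissibleSeq}

/-- A polynomial of degree at most `N` cannot attain its norm at `x` if, for far unit vectors `e`,
its expansion at `x` in the direction `e` has vanishing coefficients of order between `1` and
`M - 1` and a term of order `M` that uniformly increases the modulus in the direction `θ`. -/
theorem not_isMaxOn_of_directionalCoeff
    (Φ : ∀ l : ℕ, ContinuousMultilinearMap 𝕜 (fun _ : Fin l => LorentzPredual 𝕜 w) 𝕜)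
    {M N : ℕ} (hM : M ≠ 0) (hMN : M ≤ N) (hw : ∀ j, j ≠ 0 → j < M → ¬ Summable fun i => w i ^ j)
    {p : LorentzPredual 𝕜 w → 𝕜}
    (hp : ∀ x, p x = ∑ l ∈ Finset.range (N + 1), Φ l fun _ => x)
    {x : LorentzPredual 𝕜 w} (hx : ‖x‖ ≤ 1) {θ : 𝕜} (hθ : ‖θ‖ = 1) {κ : ℝ} (hκ : 0 < κ)
    (hcoeff : ∀ n, n ≠ 0 → κ ≤ RCLike.re
      (starRingEnd 𝕜 (p x) * (directionalCoeff Φ N x (single n) M * θ ^ M))) :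
    ∃ y, ‖y‖ ≤ 1 ∧ ‖p x‖ < ‖p y‖ := by
  by_contra! hmax
  obtain ⟨B, hB0, hB⟩ := exists_norm_directionalCoeff_le Φ N
  obtain ⟨δ, hδ, n₀, hball⟩ := exists_norm_add_smul_single_le x hx
  set D : ℝ := ‖p x‖ * (N * B) with hD
  have hD0 : 0 ≤ D := by positivity
  -- `D` bounds the coefficients of order above `M`, so for this step length they cost less than
  -- half of the gain `ρ ^ M * κ`. The index `n` is chosen afterwards to make the orders below `M`
  -- cost less than the other half.
  obtain ⟨ρ, hρ0, hρδ, hρ1, hρκ⟩ : ∃ ρ : ℝ, 0 < ρ ∧ ρ ≤ δ ∧ ρ ≤ 1 ∧ D * ρ < κ / 2 := by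
    refine ⟨min (min δ 1) (κ / (2 * (D + 1))), by positivity,
      (min_le_left _ _).trans (min_le_left _ _), (min_le_left _ _).trans (min_le_right _ _), ?_⟩
    refine (mul_le_mul_of_nonneg_left (min_le_right _ _) hD0).trans_lt ?_
    rw [mul_div_assoc', div_lt_div_iff₀ (by positivity) two_pos]
    nlinarith
  have hlim : Tendsto (fun n => ‖p x‖ * ∑ j ∈ Finset.Ico 1 M,
      ‖directionalCoeff Φ N x (single n) j‖) atTop (𝓝 0) := by
    rw [show (0 : ℝ) = ‖p x‖ * ∑ j ∈ Finset.Ico 1 M, ‖(0 : 𝕜)‖ by simp]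
    refine (tendsto_finsetSum _ fun j hj => ?_).const_mul _
    have hj := Finset.mem_Ico.mp hj
    exact (tendsto_directionalCoeff Φ N x (by omega) (hw j (by omega) hj.2)).norm
  obtain ⟨n, hn, hn₀⟩ := ((hlim.eventually_lt_const
    (show 0 < ρ ^ M * (κ / 2) by positivity)).and (eventually_ge_atTop (max n₀ 1))).exists
  have hn1 : n ≠ 0 := by have := (le_max_right n₀ 1).trans hn₀; omega
  set a := directionalCoeff Φ N x (single n) with ha
  set c : 𝕜 := (ρ : 𝕜) * θ with hc
  have hcn : ‖c‖ = ρ := by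
    rw [hc, norm_mul, hθ, mul_one, RCLike.norm_ofReal, abs_of_pos hρ0]
  have hmax' := hmax _ (hball n ((le_max_left _ _).trans hn₀) c (hcn.trans_le hρδ))
  have hexp : p (x + c • single n) = p x + ∑ j ∈ Finset.Ico 1 M, a j * c ^ j +
      a M * c ^ M + ∑ j ∈ Finset.Ico (M + 1) (N + 1), a j * c ^ j := by
    rw [hp, sum_directionalCoeff, Finset.range_eq_Ico,
      ← Finset.sum_Ico_consecutive _ (Nat.zero_le (M + 1)) (by omega),
      Finset.sum_Ico_succ_top (Nat.zero_le M),
      Finset.sum_eq_sum_Ico_succ_bot (Nat.pos_of_ne_zero hM), directionalCoeff_zero, ← hp,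
      pow_zero, mul_one, zero_add]
  have hre : RCLike.re (starRingEnd 𝕜 (p x) * p (x + c • single n)) ≤ ‖p x‖ ^ 2 := by
    refine (RCLike.re_le_norm _).trans ?_
    rw [norm_mul, RCLike.norm_conj, pow_two]
    exact mul_le_mul_of_nonneg_left hmax' (norm_nonneg _)
  have h0 : RCLike.re (starRingEnd 𝕜 (p x) * p x) = ‖p x‖ ^ 2 := by
    rw [RCLike.conj_mul, ← RCLike.ofReal_pow, RCLike.ofReal_re]
  have h1 : -(‖p x‖ * ∑ j ∈ Finset.Ico 1 M, ‖a j‖) ≤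
      RCLike.re (starRingEnd 𝕜 (p x) * ∑ j ∈ Finset.Ico 1 M, a j * c ^ j) := by
    refine neg_le_of_abs_le ((RCLike.abs_re_le_norm _).trans ?_)
    rw [norm_mul, RCLike.norm_conj]
    refine mul_le_mul_of_nonneg_left (norm_sum_le_of_le _ fun j _ => ?_) (norm_nonneg _)
    rw [norm_mul, norm_pow, hcn]
    exact mul_le_of_le_one_right (norm_nonneg _) (pow_le_one₀ hρ0.le hρ1)
  have h2 : ρ ^ M * κ ≤ RCLike.re (starRingEnd 𝕜 (p x) * (a M * c ^ M)) := by
    have : starRingEnd 𝕜 (p x) * (a M * c ^ M) =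
        ((ρ ^ M : ℝ) : 𝕜) * (starRingEnd 𝕜 (p x) * (a M * θ ^ M)) := by
      rw [hc]; push_cast; ring
    rw [this, RCLike.re_ofReal_mul]
    exact mul_le_mul_of_nonneg_left (hcoeff n hn1) (by positivity)
  have h3 : -(ρ ^ M * (D * ρ)) ≤
      RCLike.re (starRingEnd 𝕜 (p x) * ∑ j ∈ Finset.Ico (M + 1) (N + 1), a j * c ^ j) := by
    refine neg_le_of_abs_le ((RCLike.abs_re_le_norm _).trans ?_)
    rw [norm_mul, RCLike.norm_conj]
    have hterm : ∀ j ∈ Finset.Ico (M + 1) (N + 1), ‖a j * c ^ j‖ ≤ B * ρ ^ (M + 1) :=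
      fun j hj => by
        rw [norm_mul, norm_pow, hcn]
        exact mul_le_mul (hB x _ hx (norm_single_le n) j)
          (pow_le_pow_of_le_one hρ0.le hρ1 (Finset.mem_Ico.mp hj).1) (by positivity) hB0
    have hle := norm_sum_le_of_le _ hterm
    rw [Finset.sum_const, nsmul_eq_mul, Nat.card_Ico] at hle
    have hcard : ((N + 1 - (M + 1) : ℕ) : ℝ) ≤ N := by exact_mod_cast (by omega)
    calc _ ≤ ‖p x‖ * (N * (B * ρ ^ (M + 1))) := mul_le_mul_of_nonneg_left
          (hle.trans (mul_le_mul_of_nonneg_right hcard (by positivity))) (norm_nonneg _)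
      _ = _ := by rw [hD]; ring
  rw [hexp] at hre
  simp only [mul_add, map_add] at hre
  have h4 := mul_lt_mul_of_pos_left hρκ (pow_pos hρ0 M)
  nlinarith

/-- If `M` is the least exponent with `w ∈ ℓ_M` and `M ≤ N`, then `powerSum M N` cannot be
approximated by norm attaining polynomials of degree at most `N`. -/
theorem not_approximatedBy_of_summable {M N : ℕ} (hM : M ≠ 0) (hMN : M ≤ N)
    (hs : Summable fun i => w i ^ M) (hw : ∀ j, j ≠ 0 → j < M → ¬ Summable fun i => w i ^ j) :
    ¬ ApproximatedBy (homogeneousPolynomials 𝕜 (LorentzPredual 𝕜 w) N)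
      (normAttainingPolynomialsOfDegreeLE 𝕜 (LorentzPredual 𝕜 w) N) := by
  intro happ
  set S := ∑' i, w i ^ M with hSdef
  have hS1 : 1 ≤ S := by
    have := hs.sum_le_tsum {0} fun i _ => pow_nonneg (w.nonneg' i) _
    simpa [w.zero'] using this
  obtain ⟨C₁, hC₁, hcoeff⟩ := exists_norm_coeff_le 𝕜 N
  obtain ⟨C₂, hC₂, hgrow⟩ := exists_norm_le_on_ball_two 𝕜 (LorentzPredual 𝕜 w) N
  -- Replacing `q x` by `p x` and the coefficient `b` by that of `p` costs at most `ε * R = 1 / (16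
  -- * S)`, half of the guaranteed gain `1 / (8 * S)`.
  set R : ℝ := 1 + (S + 1) * (C₁ * C₂) with hR
  have hR1 : 1 ≤ R := by rw [hR]; nlinarith [mul_pos hC₁ hC₂]
  set ε : ℝ := 1 / (16 * S * R) with hε
  have hε0 : 0 < ε := by positivity
  have hεR : ε * R = 1 / (16 * S) := by rw [hε]; field_simp
  have hε16 : ε ≤ 1 / 16 := by
    rw [hε]
    exact one_div_le_one_div_of_le (by norm_num) (by nlinarith)
  have hqhom := powerSum_mem (𝕜 := 𝕜) hM hMN hs
  set q : LorentzPredual 𝕜 w → 𝕜 := powerSum M N with hq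
  obtain ⟨p, ⟨hpdeg, x, hx, hxp⟩, hqp⟩ := happ q hqhom ε hε0
  have hqdeg := homogeneousPolynomials_subset_polynomialsOfDegreeLE le_rfl hqhom
  have hrdeg := sub_mem_polynomialsOfDegreeLE hqdeg hpdeg
  have hr : ∀ y, ‖y‖ ≤ 1 → ‖(q - p) y‖ ≤ ε := fun y hy =>
    (norm_le_ballSupNorm hrdeg hy).trans hqp.le
  have hpmax : ∀ y, ‖y‖ ≤ 1 → ‖p y‖ ≤ ‖p x‖ := fun y hy =>
    hxp ▸ norm_le_ballSupNorm hpdeg hy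
  have hrx : ‖q x - p x‖ ≤ ε := hr x hx
  have hqx : ‖q x‖ ≤ S := norm_powerSum_le hs hx
  have hpS : ‖p x‖ ≤ S + 1 := by
    have := norm_sub_norm_le (p x) (q x)
    rw [norm_sub_rev] at this
    linarith
  -- `p` is maximal at `x` and close to `1` at the first unit vector, so `‖q x‖ ≥ 1 - 2 * ε`.
  have hqx2 : 1 / 2 ≤ ‖q x‖ := by
    have h1 : ‖q (single 0) - p (single 0)‖ ≤ ε := hr _ (norm_single_le 0)
    have h2 := norm_sub_norm_le (q (single 0)) (p (single 0))
    rw [hq, powerSum_single_zero hM, norm_one] at h2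
    rw [hq, powerSum_single_zero hM] at h1
    have h3 := hpmax _ (norm_single_le 0)
    have h4 := norm_sub_norm_le (p x) (q x)
    rw [norm_sub_rev] at h4
    linarith
  obtain ⟨θ, hθ, hdir⟩ := exists_direction (𝕜 := 𝕜) (N := N) hM hs hx
    (norm_pos_iff.mp (by linarith : 0 < ‖q x‖))
  obtain ⟨P, hP, hpP⟩ := hpdeg
  choose Φ hΦ using hP
  have hpΦ : ∀ y, p y = ∑ l ∈ Finset.range (N + 1), Φ l fun _ => y := fun y => by
    rw [hpP]; exact Finset.sum_congr rfl fun l _ => hΦ l y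
  set b : 𝕜 := x 0 ^ (N - M) with hb
  have hb1 : ‖b‖ ≤ 1 := by
    rw [hb, norm_pow]
    exact pow_le_one₀ (norm_nonneg _) ((norm_apply_le x 0).trans hx)
  have hbc : ∀ n, n ≠ 0 → ‖directionalCoeff Φ N x (single n) M - b‖ ≤ C₁ * (C₂ * ε) := by
    intro n hn
    obtain ⟨b', hb', hexp⟩ := powerSum_add_smul_single (𝕜 := 𝕜) hM hMN hs x hn
    rw [hb, ← hb', norm_sub_rev]
    refine hcoeff (fun j => b' j - directionalCoeff Φ N x (single n) j) _
      (fun t ht0 ht1 => ?_) M hMN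
    simp only [sub_mul, Finset.sum_sub_distrib]
    rw [← hexp, ← sum_directionalCoeff, ← hpΦ]
    -- For `t ∈ [0,1]` the point `x + t e_n` may leave the unit ball but has norm at most `2`. Using
    -- the whole interval keeps the constants independent of `x`, unlike the admissible step length
    -- at `x`.
    refine hgrow _ hrdeg ε hr _ ((norm_add_le _ _).trans ?_)
    rw [norm_smul, RCLike.norm_ofReal, abs_of_nonneg ht0]
    have := mul_le_one₀ ht1 (norm_nonneg _) (norm_single_le (𝕜 := 𝕜) (w := w) n)
    linarith
  obtain ⟨y, hy, hlt⟩ := not_isMaxOn_of_directionalCoeff Φ hM hMN hw hpΦ hx hθ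
    (κ := 1 / (16 * S)) (by positivity) fun n hn => by
      set d := directionalCoeff Φ N x (single n) M with hd
      have h1 : starRingEnd 𝕜 (q x) * (b * θ ^ M) = starRingEnd 𝕜 (p x) * (d * θ ^ M) +
          (starRingEnd 𝕜 (q x - p x) * (b * θ ^ M) -
            starRingEnd 𝕜 (p x) * ((d - b) * θ ^ M)) := by
        rw [map_sub]; ring
      have h2 : ‖starRingEnd 𝕜 (q x - p x) * (b * θ ^ M) -
          starRingEnd 𝕜 (p x) * ((d - b) * θ ^ M)‖ ≤ ε * R := by
        refine (norm_sub_le _ _).trans ?_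
        simp only [norm_mul, norm_pow, hθ, one_pow, mul_one, RCLike.norm_conj]
        have h3 := mul_le_mul hrx hb1 (norm_nonneg _) hε0.le
        have h4 := mul_le_mul hpS (hbc n hn) (norm_nonneg _) (by linarith)
        rw [hR]
        linarith
      have h5 := (RCLike.re_le_norm (starRingEnd 𝕜 (q x - p x) * (b * θ ^ M) -
          starRingEnd 𝕜 (p x) * ((d - b) * θ ^ M))).trans h2
      have h6 := congrArg RCLike.re h1
      rw [map_add] at h6
      have h7 : 2 * (1 / (16 * S)) ≤ ‖q x‖ ^ 2 / (2 * S) := by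
        rw [mul_one_div, div_le_div_iff₀ (by positivity) (by positivity)]
        have : 1 / 4 ≤ ‖q x‖ ^ 2 := by nlinarith
        nlinarith
      rw [hεR] at h5
      linarith [h7.trans hdir]
  exact absurd (hpmax y hy) (not_le.mpr hlt)

end LorentzPredual

/-! ### The equivalence. -/

theorem mainTheorem5 {𝕜 : Type*} [RCLike 𝕜] (w : AdmissibleSeq) (N : ℕ) (hN : 2 ≤ N) :
    List.TFAE
      [ ApproximatedBy (homogeneousPolynomials 𝕜 (LorentzPredual 𝕜 w) N)
          (normAttainingHomogeneousPolynomials 𝕜 (LorentzPredual 𝕜 w) N),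
        ∀ k : ℕ, N ≤ k →
          ApproximatedBy (homogeneousPolynomials 𝕜 (LorentzPredual 𝕜 w) N)
            (normAttainingPolynomialsOfDegreeLE 𝕜 (LorentzPredual 𝕜 w) k),
        ¬ Memℓp (fun i : ℕ => w i) (N : ENNReal) ] := by
  classical
  have hN0 : N ≠ 0 := by omega
  rw [w.memlp_iff hN0]
  tfae_have 1 → 2 := fun h k hk q hq ε hε => by
    obtain ⟨p, ⟨hp, hna⟩, hlt⟩ := h q hq ε hε
    exact ⟨p, ⟨homogeneousPolynomials_subset_polynomialsOfDegreeLE hk hp, hna⟩, hlt⟩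
  tfae_have 2 → 3 := fun h hs => by
    -- The least positive exponent is needed: it makes every lower directional coefficient vanish in
    -- the limit.
    have hex : ∃ j, j ≠ 0 ∧ Summable fun i => w i ^ j := ⟨N, hN0, hs⟩
    refine LorentzPredual.not_approximatedBy_of_summable (Nat.find_spec hex).1
      (Nat.find_min' hex ⟨hN0, hs⟩) (Nat.find_spec hex).2 (fun j hj hlt hsj => ?_) (h N le_rfl)
    exact Nat.find_min hex hlt ⟨hj, hsj⟩
  tfae_have 3 → 1 := LorentzPredual.approximatedBy_normAttaining_of_not_summable
  tfae_finish
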